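/- **Setting.** Let $U\subset\mathbb C^m$ be an open set with coordinates $z^1,\dots,z^m$ (a holomorphic coordinate chart of a pseudo-Kähler manifold), and let $\Phi=\frac1\nu\Phi_{-1}+\Phi_0+\nu\Phi_1+\cdots$ be a formal potential on $U$: the $\Phi_r$ ($r\ge -1$) are smooth complex-valued functions on $U$, and the matrix $g_{kl}=\partial^2\Phi_{-1}/\partial z^k\partial\bar z^l$ is Hermitian and nondegenerate at every point of $U$ (so $i\partial\bar\partial\Phi_{-1}$ is a pseudo-Kähler form and $\omega_r=i\partial\bar\partial\Phi_r$ are the coefficients of a formal deformation of it). Let $g^{lk}$ be the inverse matrix. Fix a point of $U$; all tensors below are evaluated at it. Repeated indices are summed over. **Graphs.** A *graph* is a finite directed multigraph without cycles with one source (having only outgoing edges), one sink (having only incoming edges), and finitely many (possibly no) other, *internal*, vertices carrying an integer weight. An internal vertex with $p$ incoming edges, $q$ outgoing edges and weight $r$ has type $(p,q,r)$, and it is required that $p\ge1$, $q\ge1$, $r\ge-1$, $p+q+r\ge2$. An isomorphism of graphs is a pair of bijections of the vertices and of the edges that respects source, sink, weights and the way in which edges connect vertices. Let $\mathcal A$ be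 the set of isomorphism classes of graphs, let $|Aut(\Gamma)|$ be the order of the automorphism group of $\Gamma$, and let $\hat W(\Gamma)=\sum (q+r)$, the sum being over the internal vertices of $\Gamma$, of types $(p,q,r)$. **Partition operators.** The formal Fock space is $\mathcal V=\mathbb C[[\nu,\eta^1,\dots,\eta^m]]$ with the $\mathcal I$-adic topology, $\mathcal I=\langle\nu,\eta^1,\dots,\eta^m\rangle$. To a graph $\Gamma$ whose source has $\mathbf q$ outgoing edges and whose sink has $\mathbf p$ incoming edges one relates the tensor $\hat\Gamma_K^I$, $K=k_1\dots k_{\mathbf q}$, $I=i_1\dots i_{\mathbf p}$, as follows. To each internal vertex of type $(p,q,r)$ relate the tensor $$-\frac{\partial^{p+q}\Phi_r}{\partial z^{k_1}\cdots\partial z^{k_p}\,\partial\bar z^{l_1}\cdots\partial\bar z^{l_q}}\,g^{l_1i_1}\cdots g^{l_qi_q},$$ whose lower indices $k$ belong to the incoming and whose upper indices $i$ belong to the outgoing edges; to each edge from the source to the sink relate $\delta_k^i$; for each edge between internal vertices contract the upper index at its tail with the lower index at its head; then symmetrize separately in the $\mathbf q$ free lower indices (edges leaving the source) and in the $\mathbf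 p$ free upper indices (edges entering the sink). The partition operator of $\Gamma$ is $$(\hat\Gamma f)(\nu,\eta)=\frac1{\mathbf p!}\,\hat\Gamma_{k_1\dots k_{\mathbf q}}^{i_1\dots i_{\mathbf p}}\,\eta^{k_1}\cdots\eta^{k_{\mathbf q}}\,\frac{\partial}{\partial\lambda^{i_1}}\cdots\frac{\partial}{\partial\lambda^{i_{\mathbf p}}}f(\nu,\lambda)\Big|_{\lambda=0}.$$ **Cuts.** A partition $\pi$ of the set of internal vertices of $\Gamma$ into an ordered pair of (possibly empty) subsets $E'_\pi,E''_\pi$ is *admissible* if every edge connecting $\{\text{source}\}\cup E'_\pi$ with $E''_\pi\cup\{\text{sink}\}$ has its tail in the former and its head in the latter set; $n_\pi$ is the number of these edges. The graph $\Gamma'_\pi$ is obtained from $\Gamma$ by deleting the vertices of $E''_\pi$ and all edges within $E''_\pi\cup\{\text{sink}\}$ and connecting the $n_\pi$ loose edges with the sink; $\Gamma''_\pi$ is obtained from $\Gamma$ by deleting the vertices of $E'_\pi$ and all edges within $\{\text{source}\}\cup E'_\pi$ and connecting the $n_\pi$ loose edges with the source. **Theorem.** 1. For every function $c:\mathcal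 A\to\mathbb C$ the series $\sum_{[\Gamma]\in\mathcal A}\nu^{\hat W(\Gamma)}c_\Gamma\hat\Gamma$ converges (unconditionally, on every element of $\mathcal V$) to a unique continuous $\mathbb C$-linear operator on $\mathcal V$. 2. The set $\hat{\mathcal A}$ of all operators of this form is a unital subalgebra of the $\mathbb C$-algebra of continuous $\mathbb C$-linear operators on $\mathcal V$. 3. For all functions $a,b:\mathcal A\to\mathbb C$, if $$A=\sum_{[\Gamma]\in\mathcal A}\frac{\nu^{\hat W(\Gamma)}a_\Gamma}{|Aut(\Gamma)|}\hat\Gamma,\qquad B=\sum_{[\Gamma]\in\mathcal A}\frac{\nu^{\hat W(\Gamma)}b_\Gamma}{|Aut(\Gamma)|}\hat\Gamma,$$ then $$AB=\sum_{[\Gamma]\in\mathcal A}\frac{\nu^{\hat W(\Gamma)}}{|Aut(\Gamma)|}\Big(\sum_\pi\frac{a_{\Gamma'_\pi}\,b_{\Gamma''_\pi}}{n_\pi!}\Big)\hat\Gamma,$$ where $\pi$ runs over the admissible partitions of the set of internal vertices of $\Gamma$. -/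

import Mathlib

open scoped ContDiff

noncomputable section

namespace PartitionOperators

/-! ## Potentials on a holomorphic coordinate chart -/

/-- The Wirtinger derivative `∂f/∂z^k = (∂f/∂x^k - i ∂f/∂y^k) / 2`. -/
def dz {m : ℕ} (k : Fin m) (f : (Fin m → ℂ) → ℂ) (z : Fin m → ℂ) : ℂ :=
  (1 / 2) * (fderiv ℝ f z (Pi.single k 1) - Complex.I * fderiv ℝ f z (Pi.single k Complex.I))

/-- The Wirtinger derivative `∂f/∂z̄^k = (∂f/∂x^k + i ∂f/∂y^k) / 2`. -/
def dzbar {m : ℕ} (k : Fin m) (f : (Fin m → ℂ) → ℂ) (z : Fin m → ℂ) : ℂ :=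
  (1 / 2) * (fderiv ℝ f z (Pi.single k 1) + Complex.I * fderiv ℝ f z (Pi.single k Complex.I))

/-- The mixed partial derivative
`(∂/∂z¹)^(α 1) ⋯ (∂/∂z^m)^(α m) (∂/∂z̄¹)^(β 1) ⋯ (∂/∂z̄^m)^(β m) f`.
For smooth `f` the order of the differentiations is irrelevant. -/
def mixedDeriv {m : ℕ} (α β : Fin m → ℕ) (f : (Fin m → ℂ) → ℂ) : (Fin m → ℂ) → ℂ :=
  (List.finRange m).foldr (fun k h => (dz k)^[α k] h)
    ((List.finRange m).foldr (fun l h => (dzbar l)^[β l] h) f)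

/-- The matrix `g_{kl} = ∂²φ / ∂z^k ∂z̄^l` at the point `z`. -/
def complexHessian {m : ℕ} (φ : (Fin m → ℂ) → ℂ) (z : Fin m → ℂ) :
    Matrix (Fin m) (Fin m) ℂ :=
  Matrix.of fun k l => dz k (dzbar l φ) z

/-- A formal potential `Φ = (1/ν) Φ₋₁ + Φ₀ + ν Φ₁ + ⋯` on a coordinate chart `U ⊆ ℂ^m` of a formal
deformation `ω = (1/ν) ω₋₁ + ω₀ + ν ω₁ + ⋯`, `ω_r = i ∂∂̄ Φ_r`, of the pseudo-Kähler form `ω₋₁`: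
`ω₋₁` is real (its matrix `g_{kl}` is Hermitian) and nondegenerate.
The coefficient of `ν^r` is `Φ r`; only `r ≥ -1` is ever used. -/
structure FormalPotential (m : ℕ) where
  U : Set (Fin m → ℂ)
  isOpen : IsOpen U
  Φ : ℤ → (Fin m → ℂ) → ℂ
  smooth : ∀ r : ℤ, -1 ≤ r → ContDiffOn ℝ ∞ (Φ r) U
  hermitian : ∀ z ∈ U, (complexHessian (Φ (-1)) z).IsHermitian
  nondegenerate : ∀ z ∈ U, IsUnit (complexHessian (Φ (-1)) z).det

/-! ## Directed acyclic weighted multigraphs with one source and one sink -/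

/-- A finite directed acyclic multigraph with one source and one sink and with weighted internal
vertices. `V` is the set of internal vertices and `E` the set of edges. `tail e = none` means
that the edge `e` leaves the source, `head e = none` means that `e` enters the sink.
An internal vertex `v` has type `(p, q, r)`, where `p` is the number of its incoming edges, `q` the
number of its outgoing edges and `r` its weight, with `p ≥ 1`, `q ≥ 1`, `r ≥ -1`,
`p + q + r ≥ 2`. -/
structure Graph where
  V : Type
  E : Type
  [fintypeV : Fintype V]
  [fintypeE : Fintype E]
  tail : E → Option V
  head : E → Option V
  weight : V → ℤ
  one_le_in : ∀ v, 1 ≤ Nat.card {e // head e = some v}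
  one_le_out : ∀ v, 1 ≤ Nat.card {e // tail e = some v}
  neg_one_le_weight : ∀ v, -1 ≤ weight v
  two_le : ∀ v, 2 ≤ (Nat.card {e // head e = some v} : ℤ) +
    (Nat.card {e // tail e = some v} : ℤ) + weight v
  acyclic : ∀ v, ¬ Relation.TransGen (fun a b => ∃ e, tail e = some a ∧ head e = some b) v v

attribute [instance] Graph.fintypeV Graph.fintypeE

namespace Graph

/-- An isomorphism of graphs: bijections of the internal vertices and of the edges, compatible with
tails, heads (hence with source, sink and degrees) and weights. -/
structure Iso (Γ Δ : Graph) where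
  onV : Γ.V ≃ Δ.V
  onE : Γ.E ≃ Δ.E
  tail_comp : ∀ e, Δ.tail (onE e) = (Γ.tail e).map onV
  head_comp : ∀ e, Δ.head (onE e) = (Γ.head e).map onV
  weight_comp : ∀ v, Δ.weight (onV v) = Γ.weight v

def Iso.refl (Γ : Graph) : Iso Γ Γ where
  onV := Equiv.refl _
  onE := Equiv.refl _
  tail_comp e := by simp
  head_comp e := by simp
  weight_comp v := rfl

def Iso.symm {Γ Δ : Graph} (f : Iso Γ Δ) : Iso Δ Γ where
  onV := f.onV.symm
  onE := f.onE.symm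
  tail_comp e := by
    have h := f.tail_comp (f.onE.symm e)
    rw [Equiv.apply_symm_apply] at h
    rw [h, Option.map_map]
    simp
  head_comp e := by
    have h := f.head_comp (f.onE.symm e)
    rw [Equiv.apply_symm_apply] at h
    rw [h, Option.map_map]
    simp
  weight_comp v := by
    have h := f.weight_comp (f.onV.symm v)
    rw [Equiv.apply_symm_apply] at h
    exact h.symm

def Iso.trans {Γ Δ Θ : Graph} (f : Iso Γ Δ) (g : Iso Δ Θ) : Iso Γ Θ where
  onV := f.onV.trans g.onV
  onE := f.onE.trans g.onE
  tail_comp e := by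
    simp only [Equiv.trans_apply, g.tail_comp, f.tail_comp, Option.map_map]
    rfl
  head_comp e := by
    simp only [Equiv.trans_apply, g.head_comp, f.head_comp, Option.map_map]
    rfl
  weight_comp v := by
    simp only [Equiv.trans_apply, g.weight_comp, f.weight_comp]

instance isoSetoid : Setoid Graph where
  r Γ Δ := Nonempty (Iso Γ Δ)
  iseqv :=
    { refl := fun Γ => ⟨Iso.refl Γ⟩
      symm := fun ⟨f⟩ => ⟨f.symm⟩
      trans := fun ⟨f⟩ ⟨g⟩ => ⟨f.trans g⟩ }

/-- The order of the automorphism group of `Γ`. -/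
def autCard (Γ : Graph) : ℕ := Nat.card (Iso Γ Γ)

def inDegree (Γ : Graph) (v : Γ.V) : ℕ := Nat.card {e // Γ.head e = some v}

def outDegree (Γ : Graph) (v : Γ.V) : ℕ := Nat.card {e // Γ.tail e = some v}

/-- The edges leaving the source. -/
abbrev SourceEdge (Γ : Graph) : Type := {e // Γ.tail e = none}

/-- The edges entering the sink. -/
abbrev SinkEdge (Γ : Graph) : Type := {e // Γ.head e = none}

/-- The edges leaving the internal vertex `v`. -/
abbrev OutEdge (Γ : Graph) (v : Γ.V) : Type := {e // Γ.tail e = some v}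

def sourceDegree (Γ : Graph) : ℕ := Nat.card Γ.SourceEdge

def sinkDegree (Γ : Graph) : ℕ := Nat.card Γ.SinkEdge

/-- The operator weight `∑ (q + r)` over the internal vertices of type `(p, q, r)`.
Every summand is a nonnegative integer, so `Int.toNat` does not truncate. -/
def opWeight (Γ : Graph) : ℕ := ∑ v, ((Γ.outDegree v : ℤ) + Γ.weight v).toNat

/-! ### Admissible partitions and the two pieces of a graph -/

/-- The tail of `e` lies in `{source} ∪ S`. -/
def TailLower (Γ : Graph) (S : Set Γ.V) (e : Γ.E) : Prop := ∀ v, Γ.tail e = some v → v ∈ S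

/-- The head of `e` lies in `Sᶜ ∪ {sink}`. -/
def HeadUpper (Γ : Graph) (S : Set Γ.V) (e : Γ.E) : Prop := ∀ w, Γ.head e = some w → w ∉ S

/-- The partition of the internal vertices into `E' = S` and `E'' = Sᶜ` is admissible if every edge
connecting `{source} ∪ E'` with `E'' ∪ {sink}` has its tail in the former and its head in the
latter set, that is, no edge has its tail in `E''` and its head in `E'`. -/
def Admissible (Γ : Graph) (S : Set Γ.V) : Prop := ∀ e, Γ.TailLower S e ∨ Γ.HeadUpper S e

/-- The admissible partitions of the set of internal vertices. -/
abbrev Cut (Γ : Graph) : Type := {S : Set Γ.V // Γ.Admissible S}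

instance (Γ : Graph) : Fintype Γ.Cut := Fintype.ofFinite _

/-- The number of edges from `{source} ∪ E'` to `E'' ∪ {sink}`. -/
def cutCard (Γ : Graph) (π : Γ.Cut) : ℕ :=
  Nat.card {e // Γ.TailLower π.1 e ∧ Γ.HeadUpper π.1 e}

open Classical in
/-- The vertex `a` as an element of `S`, or `none` (the source or the sink) if `a` is external
or lies outside of `S`. -/
def restrict {V : Type} (S : Set V) (a : Option V) : Option S :=
  a.bind fun v => if h : v ∈ S then some ⟨v, h⟩ else none

theorem restrict_eq_some {V : Type} {S : Set V} {a : Option V} {v : S} :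
    restrict S a = some v ↔ a = some v.1 := by
  cases a with
  | none => simp [restrict]
  | some w =>
    by_cases h : w ∈ S
    · simp [restrict, h, Subtype.ext_iff]
    · simp only [restrict, Option.bind_some, h, dite_false, Option.some.injEq, false_iff, reduceCtorEq]
      rintro rfl
      exact h v.2

/-- Degrees at the vertices of `S` do not change if all edges at these vertices are kept. -/
theorem card_restrict {V E : Type} (S : Set V) (f : E → Option V) (P : E → Prop) (v : S)
    (hP : ∀ e, f e = some v.1 → P e) :
    Nat.card {e : {e // P e} // restrict S (f e.1) = some v} = Nat.card {e // f e = some v.1} :=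
  Nat.card_congr
    { toFun := fun e => ⟨e.1.1, restrict_eq_some.1 e.2⟩
      invFun := fun e => ⟨⟨e.1, hP e.1 e.2⟩, restrict_eq_some.2 e.2⟩
      left_inv := fun _ => rfl
      right_inv := fun _ => rfl }

open Classical in
/-- The graph on the internal vertices `S` with the edges satisfying `P`, where ends outside of
`S` are moved to the source (tails) or to the sink (heads). -/
def piece (Γ : Graph) (S : Set Γ.V) (P : Γ.E → Prop)
    (hin : ∀ v ∈ S, ∀ e, Γ.head e = some v → P e)
    (hout : ∀ v ∈ S, ∀ e, Γ.tail e = some v → P e) : Graph where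
  V := S
  E := {e // P e}
  tail e := restrict S (Γ.tail e.1)
  head e := restrict S (Γ.head e.1)
  weight v := Γ.weight v.1
  one_le_in v := by
    rw [card_restrict S Γ.head P v (hin v.1 v.2)]; exact Γ.one_le_in v.1
  one_le_out v := by
    rw [card_restrict S Γ.tail P v (hout v.1 v.2)]; exact Γ.one_le_out v.1
  neg_one_le_weight v := Γ.neg_one_le_weight v.1
  two_le v := by
    rw [card_restrict S Γ.head P v (hin v.1 v.2), card_restrict S Γ.tail P v (hout v.1 v.2)]
    exact Γ.two_le v.1
  acyclic v h := Γ.acyclic v.1 (by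
    refine Relation.TransGen.lift Subtype.val ?_ _ _ h
    rintro a b ⟨e, h1, h2⟩
    exact ⟨e.1, restrict_eq_some.1 h1, restrict_eq_some.1 h2⟩)

/-- `Γ'_π`: delete the vertices of `E''` and the edges within `E'' ∪ {sink}`, and connect the loose
edges with the sink. -/
def lowerPiece (Γ : Graph) (π : Γ.Cut) : Graph :=
  Γ.piece π.1 (Γ.TailLower π.1)
    (fun v hv e he => (π.2 e).resolve_right fun h => h v he hv)
    (fun v hv e he w hw => by
      rw [he] at hw
      cases hw
      exact hv)

/-- `Γ''_π`: delete the vertices of `E'` and the edges within `{source} ∪ E'`, and connect the loose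
edges with the source. -/
def upperPiece (Γ : Graph) (π : Γ.Cut) : Graph :=
  Γ.piece π.1ᶜ (Γ.HeadUpper π.1)
    (fun v hv e he w hw => by
      rw [he] at hw
      cases hw
      exact hv)
    (fun v hv e he => (π.2 e).resolve_left fun h => hv (h v he))

end Graph

/-- The set `𝒜` of isomorphism classes of graphs. -/
abbrev IsoClass : Type 1 := Quotient Graph.isoSetoid

/-- A representative of an isomorphism class. -/
def IsoClass.rep (γ : IsoClass) : Graph := Quotient.out γ

/-- The coefficient `∑_π a(Γ'_π) b(Γ''_π) / n_π!` of the composition formula, `π` running over the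
admissible partitions of the set of internal vertices of `Γ`. -/
def cutSum (a b : IsoClass → ℂ) (Γ : Graph) : ℂ :=
  ∑ π : Γ.Cut, a (Quotient.mk _ (Γ.lowerPiece π)) * b (Quotient.mk _ (Γ.upperPiece π)) /
    ((Γ.cutCard π).factorial : ℂ)

/-! ## The formal Fock space -/

/-- The formal Fock space `ℂ[[ν, η¹, …, η^m]]`; the variable `ν` has the index `none`, the variable
`η^k` the index `some k`. -/
abbrev FockSpace (m : ℕ) : Type := MvPowerSeries (Option (Fin m)) ℂ

namespace FockSpace

def nu {m : ℕ} : FockSpace m := MvPowerSeries.X none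

def eta {m : ℕ} (k : Fin m) : FockSpace m := MvPowerSeries.X (some k)

/-- The Fock space carries the `I`-adic topology of the ideal `I = ⟨ν, η¹, …, η^m⟩`. -/
instance (m : ℕ) : WithIdeal (FockSpace m) :=
  ⟨Ideal.span (Set.range (MvPowerSeries.X : Option (Fin m) → FockSpace m))⟩

instance (m : ℕ) : ContinuousConstSMul ℂ (FockSpace m) where
  continuous_const_smul c := by
    have h : (fun f : FockSpace m => c • f) = fun f => MvPowerSeries.C c * f := by
      funext f
      rw [MvPowerSeries.smul_eq_C_mul]
    rw [h]
    exact continuous_const.mul continuous_id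

/-- Setting `η = 0`. -/
def etaZero {m : ℕ} : FockSpace m →ₗ[ℂ] FockSpace m where
  toFun f := fun n => if ∀ k : Fin m, n (some k) = 0 then MvPowerSeries.coeff n f else 0
  map_add' f g := by
    funext n
    change (if _ then MvPowerSeries.coeff n (f + g) else 0) =
      (if _ then MvPowerSeries.coeff n f else 0) + (if _ then MvPowerSeries.coeff n g else 0)
    split_ifs <;> simp
  map_smul' c f := by
    funext n
    change (if _ then MvPowerSeries.coeff n (c • f) else 0) =
      c * (if _ then MvPowerSeries.coeff n f else 0)
    split_ifs <;> simp

/-- The partial derivative `∂/∂η^k`. -/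
def dEta {m : ℕ} (k : Fin m) : FockSpace m →ₗ[ℂ] FockSpace m :=
  (MvPowerSeries.pderiv ℂ (some k)).toLinearMap

/-- `f ↦ (∂/∂λ)^I f(ν, λ) |_{λ=0}` for the tensor index `I = i₁ … i_p`. -/
def derivAtZero {m p : ℕ} (I : Fin p → Fin m) : FockSpace m →ₗ[ℂ] FockSpace m :=
  etaZero ∘ₗ ((List.ofFn I).map dEta).prod

/-- The operator
`(A f)(ν, η) = (1 / |I|!) A_K^I η^K (∂/∂λ)^I f(ν, λ) |_{λ=0}` (summation over `I` and `K`) whose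
matrix `A_K^I` vanishes unless `|K| = q` and `|I| = p` and does not depend on `ν`. -/
def operatorOfMatrix {m q p : ℕ} (A : (Fin q → Fin m) → (Fin p → Fin m) → ℂ) :
    FockSpace m →ₗ[ℂ] FockSpace m :=
  ((p.factorial : ℂ)⁻¹) • ∑ K : Fin q → Fin m, ∑ I : Fin p → Fin m,
    A K I • (LinearMap.mulLeft ℂ (∏ j, eta (K j)) ∘ₗ derivAtZero I)

end FockSpace

/-! ## Partition operators -/

namespace FormalPotential

variable {m : ℕ} (P : FormalPotential m) (x : Fin m → ℂ)

/-- The tensor `g^{lk}`, inverse to `g_{kl} = ∂²Φ₋₁ / ∂z^k ∂z̄^l`, at the point `x`. -/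
def gInv : Matrix (Fin m) (Fin m) ℂ := (complexHessian (P.Φ (-1)) x)⁻¹

open Classical in
/-- The component of the tensor
`- (∂^{p+q} Φ_r / ∂z^{k_1} ⋯ ∂z^{k_p} ∂z̄^{l_1} ⋯ ∂z̄^{l_q}) g^{l_1 i_1} ⋯ g^{l_q i_q}`
(summation over the `l`'s) at the internal vertex `v`, where every edge `e` carries the tensor
index `c e`: the `k`'s are the indices of the incoming edges of `v`, the `i`'s the indices of the
outgoing edges. -/
def vertexTensor (Γ : Graph) (c : Γ.E → Fin m) (v : Γ.V) : ℂ :=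
  ∑ l : Γ.OutEdge v → Fin m,
    -(mixedDeriv (fun k => Nat.card {e // Γ.head e = some v ∧ c e = k})
        (fun k => Nat.card {e // l e = k}) (P.Φ (Γ.weight v)) x) *
      ∏ e : Γ.OutEdge v, P.gInv x (l e) (c e.1)

open Classical in
/-- The contracted tensor of the graph before symmetrization. The edges leaving the source carry
the free lower indices `K`, the edges entering the sink carry the free upper indices `I`; an edge
from the source to the sink carries both, which have to be equal (Kronecker tensor). The indices of
all other edges are summed over. -/
def rawTensor (Γ : Graph) (K : Γ.SourceEdge → Fin m) (I : Γ.SinkEdge → Fin m) : ℂ :=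
  ∑ c : Γ.E → Fin m,
    if (∀ e : Γ.SourceEdge, c e.1 = K e) ∧ (∀ e : Γ.SinkEdge, c e.1 = I e) then
      ∏ v, P.vertexTensor x Γ c v
    else 0

open Classical in
/-- The tensor `Γ̂_K^I`: the contracted tensor, symmetrized separately in the lower and in the upper
indices. -/
def graphTensor (Γ : Graph) (K : Fin Γ.sourceDegree → Fin m) (I : Fin Γ.sinkDegree → Fin m) : ℂ :=
  ((Γ.sourceDegree.factorial : ℂ) * (Γ.sinkDegree.factorial : ℂ))⁻¹ *
    ∑ σ : Γ.SourceEdge ≃ Fin Γ.sourceDegree, ∑ τ : Γ.SinkEdge ≃ Fin Γ.sinkDegree,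
      P.rawTensor x Γ (K ∘ σ) (I ∘ τ)

/-- The partition operator `Γ̂` at the point `x`. -/
def partitionOperator (Γ : Graph) : FockSpace m →ₗ[ℂ] FockSpace m :=
  FockSpace.operatorOfMatrix (P.graphTensor x Γ)

/-- `A = ∑ ν^{Ŵ(Γ)} c_Γ Γ̂`, the sum over the isomorphism classes converging on every element of the
Fock space. -/
def Represents (c : IsoClass → ℂ) (A : FockSpace m →L[ℂ] FockSpace m) : Prop :=
  ∀ f : FockSpace m,
    HasSum (fun γ : IsoClass =>
      FockSpace.nu ^ γ.rep.opWeight * (c γ • P.partitionOperator x γ.rep f)) (A f)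

/-- The set `𝒜̂` of continuous operators of the form `∑ ν^{Ŵ(Γ)} c_Γ Γ̂`. -/
def graphOperators : Set (FockSpace m →L[ℂ] FockSpace m) :=
  {A | ∃ c : IsoClass → ℂ, P.Represents x c A}

end FormalPotential

end PartitionOperators

end

/-! Expanded over colourings of the edges by tensor indices, a partition operator is a sum in which
the edges leaving the source give a monomial in the η's, the edges entering the sink a Taylor
coefficient at η = 0, and the internal vertices scalars. In a product `Γ̂₁ Γ̂₂` the sink derivatives
of `Γ₁` act on the source monomial of `Γ₂`, and a derivative of a monomial at η = 0 counts the
bijections of its factors with the derivatives that preserve indices (`taylorCoeff_prod_eta_mul`).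
So `Γ̂₁ Γ̂₂` is `1/p!` times the sum of the operators of all graphs obtained by joining the `p` sink
edges of `Γ₁` to the source edges of `Γ₂` (`partitionOperator_comp`).

The composition formula then follows by double counting. A presentation of `Γ` as a composite of
`Γ₁` and `Γ₂` is either a matching with an isomorphism from the glued graph to `Γ`, or an admissible
partition of `Γ` with isomorphisms from `Γ₁` and `Γ₂` to its pieces (`sum_card_iso_glue`). The
automorphism factors cancel the numbers of isomorphisms, and `p!` becomes `n_π!`.

Convergence rests on `card_vertices_add_sinkDegree_le`, a consequence of `p + q + r ≥ 2` and `r ≥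
-1`: the number of vertices and the sink degree are controlled by the source degree and `Ŵ`. The
term of `Γ` lies in the power of the ideal with exponent `Ŵ` plus source degree, so modulo each
power only finitely many classes matter (`finite_isoClass`); this also permits the rearrangement of
the double series. The unit is the sum of the graphs without internal vertices, which are the
projections to the homogeneous components in η. -/

noncomputable section

namespace PartitionOperators

/-! ### The adic topology in terms of coefficients. -/

namespace FockSpace

open MvPowerSeries Finsupp Topology Filter

variable {m : ℕ}

/-- The ideal `I = ⟨ν, η¹, …, η^m⟩`. -/
def maxIdeal (m : ℕ) : Ideal (FockSpace m) := WithIdeal.i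

/-- Every nonconstant monomial is assigned one variable dividing it. Since there are finitely many
variables, collecting monomials by assigned variable writes `f` as a finite sum `∑ X i * g i`, where
the order condition on `g i` drops by one. -/
theorem mem_maxIdeal_pow_of_coeff {N : ℕ} : ∀ {f : FockSpace m},
    (∀ n, n.degree < N → coeff n f = 0) → f ∈ maxIdeal m ^ N := by
  induction N with
  | zero => simp
  | succ N ih =>
    intro f hf
    classical
    have hch : ∀ n : Option (Fin m) →₀ ℕ, ∃ i, n ≠ 0 → n i ≠ 0 := fun n => by
      by_cases h : n = 0
      · exact ⟨none, fun h' => (h' h).elim⟩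
      · obtain ⟨i, hi⟩ := Finsupp.ne_iff.1 h
        exact ⟨i, fun _ => hi⟩
    choose ch hch using hch
    -- `g i` is the part of `f` assigned to the variable `i`, divided by `X i`; the value of `ch` at
    -- 0 never matters, because `f` has no constant term.
    let g : Option (Fin m) → FockSpace m := fun i n =>
      if ch (n + single i 1) = i then coeff (n + single i 1) f else 0
    have hgc : ∀ i n, coeff n (g i) =
        if ch (n + single i 1) = i then coeff (n + single i 1) f else 0 := fun _ _ => rfl
    have hg : ∀ i, g i ∈ maxIdeal m ^ N := fun i => ih fun n hn => by
      rw [hgc, hf _ (by simp only [map_add, degree_single]; omega), ite_self]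
    have hsum : f = ∑ i, X i * g i := by
      ext n
      rw [map_sum]
      by_cases h : n = 0
      · subst h
        rw [hf 0 (by simp), Finset.sum_eq_zero]
        intro i _
        rw [coeff_zero_X_mul]
      · have h1 : ∀ i, coeff n (X i * g i) = if i = ch n then coeff n f else 0 := by
          intro i
          rw [show (X i : FockSpace m) = monomial (single i 1) 1 from rfl, coeff_monomial_mul,
            one_mul]
          by_cases hi : single i 1 ≤ n
          · rw [if_pos hi, hgc, tsub_add_cancel_of_le hi]
            simp only [eq_comm]
          · rw [if_neg hi, if_neg]
            rintro rfl
            exact hi (Finsupp.single_le_iff.2 (Nat.one_le_iff_ne_zero.2 (hch n h)))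
        simp only [h1, Finset.sum_ite_eq', Finset.mem_univ, if_true]
    rw [hsum, pow_succ']
    exact sum_mem fun i _ => Ideal.mul_mem_mul
      (Ideal.subset_span (Set.mem_range_self i)) (hg i)

/-- The powers of the ideal are the order filtration: the order is superadditive under products, and
each generator has order at least 1. -/
theorem mem_maxIdeal_pow {N : ℕ} {f : FockSpace m} :
    f ∈ maxIdeal m ^ N ↔ ∀ n, n.degree < N → coeff n f = 0 := by
  refine ⟨fun hf => ?_, mem_maxIdeal_pow_of_coeff⟩
  suffices h : (N : ℕ∞) ≤ f.order by
    exact fun n hn => coeff_of_lt_order (lt_of_lt_of_le (by exact_mod_cast hn) h)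
  have h1 : ∀ g ∈ maxIdeal m, (1 : ℕ∞) ≤ g.order := by
    intro g hg
    rw [one_le_order_iff_constCoeff_eq_zero, ← RingHom.mem_ker]
    revert g
    change maxIdeal m ≤ RingHom.ker _
    refine Ideal.span_le.2 ?_
    rintro _ ⟨i, rfl⟩
    simp [RingHom.mem_ker]
  refine Submodule.pow_induction_on_left' (M := maxIdeal m)
    (C := fun N f _ => (N : ℕ∞) ≤ f.order) ?_ ?_ ?_ hf
  · intro r; simp
  · intro f g N _ _ hf hg
    exact (le_min hf hg).trans min_order_le_add
  · intro g hg N f _ hf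
    refine le_trans ?_ le_order_mul
    rw [Nat.cast_succ, add_comm]
    exact add_le_add (h1 g hg) hf

theorem nhds_zero_hasBasis : (𝓝 (0 : FockSpace m)).HasBasis (fun _ : ℕ => True)
    fun N => ((maxIdeal m ^ N : Ideal (FockSpace m)) : Set (FockSpace m)) :=
  (WithIdeal.i : Ideal (FockSpace m)).hasBasis_nhds_zero_adic

theorem isClosed_maxIdeal_pow (N : ℕ) :
    IsClosed ((maxIdeal m ^ N : Ideal (FockSpace m)) : Set (FockSpace m)) := by
  have h : IsOpen ((maxIdeal m ^ N).toAddSubgroup : Set (FockSpace m)) :=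
    AddSubgroup.isOpen_of_mem_nhds _ (g := 0) (nhds_zero_hasBasis.mem_of_mem (i := N) trivial)
  exact AddSubgroup.isClosed_of_isOpen _ h

/-- The powers of the ideal intersect in 0. Uniqueness of all infinite sums below depends on this.
-/
instance : T2Space (FockSpace m) := by
  have : T1Space (FockSpace m) := by
    refine IsTopologicalAddGroup.t1Space _ ?_
    have : ({0} : Set (FockSpace m)) = ⋂ N : ℕ, ((maxIdeal m ^ N : Ideal (FockSpace m)) : Set _) := by
      ext f
      simp only [Set.mem_singleton_iff, Set.mem_iInter, SetLike.mem_coe, mem_maxIdeal_pow]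
      refine ⟨fun h => by simp [h], fun h => ?_⟩
      ext n
      simpa using h (n.degree + 1) n (Nat.lt_succ_self _)
    rw [this]
    exact isClosed_iInter isClosed_maxIdeal_pow
  infer_instance

/-- If all but finitely many terms lie in each power of the ideal, each coefficient is a finite sum,
and any finite set containing the terms outside the `N`-th power already gives the right
coefficients in degrees below `N`. -/
theorem hasSum_of_coeff {ι : Type*} {F : ι → FockSpace m} {s : FockSpace m}
    (hF : ∀ N, {i | F i ∉ maxIdeal m ^ N}.Finite)
    (hs : ∀ n, coeff n s = ∑ᶠ i, coeff n (F i)) : HasSum F s := by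
  classical
  rw [HasSum, SummationFilter.unconditional_filter, ← tendsto_sub_nhds_zero_iff, nhds_zero_hasBasis.tendsto_right_iff]
  intro N _
  filter_upwards [eventually_ge_atTop (hF N).toFinset] with S hS
  refine mem_maxIdeal_pow.2 fun n hn => ?_
  rw [map_sub, map_sum, hs, finsum_eq_sum_of_support_subset (s := S), sub_self]
  intro i hi
  refine hS ?_
  simp only [Set.Finite.mem_toFinset, Set.mem_ofPred_eq]
  exact fun h => hi (mem_maxIdeal_pow.1 h n hn)

theorem summable_of_finite {ι : Type*} {F : ι → FockSpace m}
    (hF : ∀ N, {i | F i ∉ maxIdeal m ^ N}.Finite) : Summable F :=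
  ⟨fun n => ∑ᶠ i, coeff n (F i), hasSum_of_coeff hF fun _ => rfl⟩

/-- A linear operator is continuous in the `I`-adic topology if it maps small powers of `I` into
given ones. -/
theorem continuous_of_pow (T : FockSpace m →ₗ[ℂ] FockSpace m)
    (hT : ∀ N, ∃ M, ∀ f ∈ maxIdeal m ^ M, T f ∈ maxIdeal m ^ N) : Continuous T := by
  refine continuous_of_continuousAt_zero T ?_
  rw [ContinuousAt, map_zero]
  refine (nhds_zero_hasBasis.tendsto_iff nhds_zero_hasBasis).2 fun N _ => ?_
  obtain ⟨M, hM⟩ := hT N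
  exact ⟨M, trivial, fun f hf => hM f hf⟩

end FockSpace

end PartitionOperators

end

noncomputable section

/-! ### Monomials, Taylor coefficients and index-preserving bijections. -/

namespace PartitionOperators

open MvPowerSeries Finsupp

/-- The exponent of the monomial `∏ s, η^(I s)`. -/
def exponent {m : ℕ} {S : Type*} [Fintype S] (I : S → Fin m) : Option (Fin m) →₀ ℕ :=
  ∑ s, single (some (I s)) 1

section exponent

variable {m : ℕ} {S T : Type*} [Fintype S] [Fintype T]

theorem exponent_none (I : S → Fin m) : exponent I none = 0 := by
  simp [exponent, Finsupp.finsetSum_apply]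

theorem exponent_some (I : S → Fin m) (k : Fin m) :
    exponent I (some k) = Nat.card {s // I s = k} := by
  classical
  simp only [exponent, Finsupp.finsetSum_apply, Finsupp.single_apply, Option.some.injEq,
    Finset.sum_boole, Nat.card_eq_fintype_card, Fintype.card_subtype, Nat.cast_id]

theorem exponent_comp (I : T → Fin m) (e : S ≃ T) : exponent (I ∘ e) = exponent I :=
  e.sum_comp fun t => single (some (I t)) 1

theorem degree_exponent (I : S → Fin m) : (exponent I).degree = Fintype.card S := by
  simp [exponent, map_sum]

/-- The product of the factorials of the exponents of the `η^k`. -/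
def etaFactorial (n : Option (Fin m) →₀ ℕ) : ℕ := ∏ k : Fin m, (n (some k)).factorial

theorem etaFactorial_add_single (n : Option (Fin m) →₀ ℕ) (k : Fin m) :
    etaFactorial (n + single (some k) 1) = (n (some k) + 1) * etaFactorial n := by
  classical
  unfold etaFactorial
  rw [← Finset.mul_prod_erase _ _ (Finset.mem_univ k),
    ← Finset.mul_prod_erase (a := k) _ (fun k => (n (some k)).factorial) (Finset.mem_univ k)]
  rw [← mul_assoc]
  congr 1
  · simp [Nat.factorial_succ]
  · refine Finset.prod_congr rfl fun i hi => ?_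
    have : k ≠ i := fun h => (Finset.mem_erase.1 hi).1 h.symm
    simp [this]

/-- The bijections `σ` with `L ∘ σ = I` are families of bijections of the fibres. -/
def fiberEquivs (I : S → Fin m) (L : T → Fin m) :
    {σ : S ≃ T // ∀ s, L (σ s) = I s} ≃ ∀ k, {s // I s = k} ≃ {t // L t = k} where
  toFun σ k := σ.1.subtypeEquiv fun s => by rw [σ.2]
  invFun g := ⟨(Equiv.sigmaFiberEquiv I).symm.trans
      ((Equiv.sigmaCongrRight g).trans (Equiv.sigmaFiberEquiv L)), fun s =>
        (g (I s) ⟨s, rfl⟩).2⟩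
  left_inv σ := by ext; rfl
  right_inv g := by
    funext k
    ext ⟨s, hs⟩
    subst hs
    rfl

/-- Fibrewise over the index `k`, such a bijection is an arbitrary bijection of two finite sets. It
exists only for equal cardinalities, and then the number is a factorial. -/
theorem card_matchings (I : S → Fin m) (L : T → Fin m) [Decidable (exponent I = exponent L)] :
    Nat.card {σ : S ≃ T // ∀ s, L (σ s) = I s} =
      if exponent I = exponent L then etaFactorial (exponent I) else 0 := by
  classical
  rw [Nat.card_congr (fiberEquivs I L), Nat.card_pi]
  split_ifs with h
  · refine Finset.prod_congr rfl fun k _ => ?_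
    have hk := DFunLike.congr_fun h (some k)
    rw [exponent_some, exponent_some] at hk
    obtain ⟨e⟩ := Fintype.card_eq.1 (by simpa [Nat.card_eq_fintype_card] using hk)
    rw [exponent_some, Nat.card_eq_fintype_card, Fintype.card_equiv e, Nat.card_eq_fintype_card]
  · obtain ⟨k, hk⟩ : ∃ k, exponent I (some k) ≠ exponent L (some k) := by
      by_contra! hc
      refine h (Finsupp.ext fun i => ?_)
      cases i with
      | none => rw [exponent_none, exponent_none]
      | some k => exact hc k
    rw [exponent_some, exponent_some] at hk
    refine Finset.prod_eq_zero (Finset.mem_univ k) ?_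
    have : IsEmpty ({s // I s = k} ≃ {t // L t = k}) := ⟨fun e => hk (Nat.card_congr e)⟩
    exact Nat.card_of_isEmpty

end exponent

namespace FockSpace

variable {m : ℕ} {S T : Type*} [Fintype S] [Fintype T]

theorem prod_eta (I : S → Fin m) : ∏ s, eta (I s) = monomial (R := ℂ) (exponent I) 1 := by
  classical
  unfold exponent
  generalize (Finset.univ : Finset S) = A
  induction A using Finset.induction_on with
  | empty => simp
  | insert a A ha ih =>
    rw [Finset.prod_insert ha, Finset.sum_insert ha, ih, eta, X, monomial_mul_monomial, one_mul]

/-- The derivative `∏ s, ∂/∂λ^(I s)` at `λ = 0`. -/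
def taylorCoeff (I : S → Fin m) : FockSpace m →ₗ[ℂ] FockSpace m where
  toFun f := fun n => if ∀ k : Fin m, n (some k) = 0 then
    etaFactorial (exponent I) * coeff (n + exponent I) f else 0
  map_add' f g := by
    funext n
    change (if _ then _ * coeff _ (f + g) else 0) =
      (if _ then _ * coeff _ f else 0) + (if _ then _ * coeff _ g else 0)
    split_ifs <;> simp [mul_add]
  map_smul' c f := by
    funext n
    change (if _ then _ * coeff _ (c • f) else 0) = c * (if _ then _ * coeff _ f else 0)
    split_ifs <;> simp [mul_left_comm]

theorem coeff_taylorCoeff (I : S → Fin m) (f : FockSpace m) (n : Option (Fin m) →₀ ℕ) :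
    coeff n (taylorCoeff I f) = if ∀ k : Fin m, n (some k) = 0 then
      etaFactorial (exponent I) * coeff (n + exponent I) f else 0 := rfl

theorem taylorCoeff_comp (I : T → Fin m) (e : S ≃ T) : taylorCoeff (I ∘ e) = taylorCoeff I := by
  ext f n
  rw [coeff_taylorCoeff, coeff_taylorCoeff, exponent_comp]

/-- Coefficients multiplied by the factorials of their exponents are merely shifted by a partial
derivative, so iteration produces no falling factorials. -/
theorem coeff_prod_dEta {p : ℕ} : ∀ (I : Fin p → Fin m) (f : FockSpace m) (n),
    etaFactorial n * coeff n (((List.ofFn I).map dEta).prod f) =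
      etaFactorial (n + exponent I) * coeff (n + exponent I) f := by
  induction p with
  | zero => intro I f n; simp [exponent]
  | succ p ih =>
    intro I f n
    have h : exponent I = single (some (I 0)) 1 + exponent fun j : Fin p => I j.succ := by
      rw [exponent, Fin.sum_univ_succ]; rfl
    rw [List.ofFn_succ, List.map_cons, List.prod_cons, Module.End.mul_apply, h, ← add_assoc,
      ← ih (fun j => I j.succ), etaFactorial_add_single]
    change _ * coeff n (pderiv ℂ (some (I 0)) _) = _
    rw [coeff_pderiv]
    push_cast
    ring

/-- Frees the iterated derivative from the order of its indices, so that it can be indexed by a set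
of edges without a numbering. -/
theorem derivAtZero_eq {p : ℕ} (I : Fin p → Fin m) : derivAtZero I = taylorCoeff I := by
  ext f n
  rw [coeff_taylorCoeff]
  change (if ∀ k : Fin m, n (some k) = 0 then
    coeff n (((List.ofFn I).map dEta).prod f) else 0) = _
  split_ifs with hn
  · have h := coeff_prod_dEta I f n
    have h0 : etaFactorial n = 1 := Finset.prod_eq_one fun k _ => by rw [hn k]; rfl
    have h1 : etaFactorial (n + exponent I) = etaFactorial (exponent I) := by
      unfold etaFactorial
      simp [hn]
    rw [h0, h1, Nat.cast_one, one_mul] at h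
    exact h
  · rfl

theorem taylorCoeff_nu_pow_mul (I : S → Fin m) (w : ℕ) (f : FockSpace m) :
    taylorCoeff I (nu ^ w * f) = nu ^ w * taylorCoeff I f := by
  ext n
  have hs : ∀ k : Fin m, single (none : Option (Fin m)) w (some k) = 0 := fun k => by simp
  have hle : single none w ≤ n + exponent I ↔ single none w ≤ n := by
    simp [Finsupp.single_le_iff, exponent_none]
  rw [coeff_taylorCoeff, nu, X_pow_eq, coeff_monomial_mul, coeff_monomial_mul, coeff_taylorCoeff]
  by_cases h : single none w ≤ n
  · rw [if_pos (hle.2 h), if_pos h, one_mul, one_mul, tsub_add_eq_add_tsub h]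
    simp only [Finsupp.tsub_apply, hs, tsub_zero]
  · rw [if_neg (fun h' => h (hle.1 h')), if_neg h, mul_zero, ite_self]

/-- The series `taylorCoeff J f` contains no η, so only the monomial is differentiated. The result
at η = 0 survives exactly when the exponents agree, with the factor counted by `card_matchings`.
This is where the gluings of graphs come from. -/
theorem taylorCoeff_prod_eta_mul {U : Type*} [Fintype U] (I : S → Fin m) (L : T → Fin m)
    (J : U → Fin m) (f : FockSpace m) :
    taylorCoeff I ((∏ t, eta (L t)) * taylorCoeff J f) =
      (Nat.card {σ : S ≃ T // ∀ s, L (σ s) = I s} : ℂ) • taylorCoeff J f := by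
  classical
  ext n
  rw [card_matchings, prod_eta, coeff_taylorCoeff, coeff_monomial_mul, one_mul, coeff_smul]
  by_cases hn : ∀ k : Fin m, n (some k) = 0
  · rw [if_pos hn]
    by_cases h : exponent I = exponent L
    · rw [if_pos h, h, if_pos le_add_self, add_tsub_cancel_right]
    · rw [if_neg h, Nat.cast_zero, zero_mul]
      split_ifs with hle
      · rw [coeff_taylorCoeff, if_neg, mul_zero]
        intro h0
        refine h (Finsupp.ext fun i => ?_)
        cases i with
        | none => rw [exponent_none, exponent_none]
        | some k =>
          have h1 := hle (some k)
          have h2 := h0 k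
          simp only [Finsupp.tsub_apply, Finsupp.add_apply, hn k] at h1 h2
          omega
      · rw [mul_zero]
  · rw [if_neg hn, coeff_taylorCoeff, if_neg hn, mul_zero]

end FockSpace

end PartitionOperators

end

noncomputable section

/-! ### Expansion of partition operators over edge colourings. -/

namespace PartitionOperators

open MvPowerSeries FockSpace

namespace Graph

/-- The equality of the tensors at two internal vertices with the same weight whose edges
correspond to each other and carry the same indices. -/
theorem vertexTensor_congr {m : ℕ} (P : FormalPotential m) (x : Fin m → ℂ) {Γ Δ : Graph}
    {c : Γ.E → Fin m} {d : Δ.E → Fin m} {v : Γ.V} {w : Δ.V} (hw : Γ.weight v = Δ.weight w)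
    (eo : Γ.OutEdge v ≃ Δ.OutEdge w) (ho : ∀ e, d (eo e).1 = c e.1)
    (ei : {e // Γ.head e = some v} ≃ {e // Δ.head e = some w}) (hi : ∀ e, d (ei e).1 = c e.1) :
    P.vertexTensor x Γ c v = P.vertexTensor x Δ d w := by
  classical
  unfold FormalPotential.vertexTensor
  refine Fintype.sum_equiv (eo.arrowCongr (Equiv.refl _)) _ _ fun l => ?_
  have h1 : ∀ k, Nat.card {e // Γ.head e = some v ∧ c e = k} =
      Nat.card {e // Δ.head e = some w ∧ d e = k} := fun k =>
    Nat.card_congr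
      { toFun := fun e => ⟨(ei ⟨e.1, e.2.1⟩).1, (ei ⟨e.1, e.2.1⟩).2, (hi _).trans e.2.2⟩
        invFun := fun e => ⟨(ei.symm ⟨e.1, e.2.1⟩).1, (ei.symm ⟨e.1, e.2.1⟩).2, by
          rw [← hi]; simpa using e.2.2⟩
        left_inv := fun e => by simp
        right_inv := fun e => by simp }
  have h2 : ∀ k, Nat.card {e // l e = k} =
      Nat.card {e // (eo.arrowCongr (Equiv.refl (Fin m))) l e = k} := fun k =>
    Nat.card_congr (eo.subtypeEquiv fun e => by simp)
  simp only [h1, h2, hw]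
  congr 1
  refine Fintype.prod_equiv eo _ _ fun e => ?_
  simp [ho]

end Graph

namespace FormalPotential

variable {m : ℕ} (P : FormalPotential m) (x : Fin m → ℂ)

open Classical in
/-- The term of the partition operator of a graph with given tensor indices of all edges. -/
def colorTerm (Γ : Graph) (c : Γ.E → Fin m) (f : FockSpace m) : FockSpace m :=
  (∏ e : Γ.SourceEdge, eta (c e.1)) * taylorCoeff (fun e : Γ.SinkEdge => c e.1) f

-- The symmetrization is redundant: the tensor is contracted with a commutative monomial and with
-- commuting derivatives, so all pairs of numberings contribute equally and their number cancels the
-- two factorials. Only the explicit `1/p!` remains.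
open Classical in
theorem partitionOperator_apply (Γ : Graph) (f : FockSpace m) :
    P.partitionOperator x Γ f = (Γ.sinkDegree.factorial : ℂ)⁻¹ •
      ∑ c : Γ.E → Fin m, (∏ v, P.vertexTensor x Γ c v) • colorTerm Γ c f := by
  have hq : Fintype.card Γ.SourceEdge = Γ.sourceDegree := Nat.card_eq_fintype_card.symm
  have hp : Fintype.card Γ.SinkEdge = Γ.sinkDegree := Nat.card_eq_fintype_card.symm
  let σ₀ : Γ.SourceEdge ≃ Fin Γ.sourceDegree := Fintype.equivFinOfCardEq hq
  let τ₀ : Γ.SinkEdge ≃ Fin Γ.sinkDegree := Fintype.equivFinOfCardEq hp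
  have hσ : Fintype.card (Γ.SourceEdge ≃ Fin Γ.sourceDegree) = Γ.sourceDegree.factorial := by
    rw [Fintype.card_equiv σ₀, hq]
  have hτ : Fintype.card (Γ.SinkEdge ≃ Fin Γ.sinkDegree) = Γ.sinkDegree.factorial := by
    rw [Fintype.card_equiv τ₀, hp]
  -- The contribution of one pair of numberings, independent of the pair: the sums over `K` and `I`
  -- remove the constraints that fix the colours of the external edges.
  have key : ∀ (σ : Γ.SourceEdge ≃ Fin Γ.sourceDegree) (τ : Γ.SinkEdge ≃ Fin Γ.sinkDegree),
      ∑ K : Fin Γ.sourceDegree → Fin m, ∑ I : Fin Γ.sinkDegree → Fin m,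
        P.rawTensor x Γ (K ∘ σ) (I ∘ τ) • ((∏ j, eta (K j)) * derivAtZero I f) =
      ∑ c : Γ.E → Fin m, (∏ v, P.vertexTensor x Γ c v) • colorTerm Γ c f := by
    intro σ τ
    have h1 : ∀ K : Γ.SourceEdge → Fin m, ∀ I : Γ.SinkEdge → Fin m,
        P.rawTensor x Γ K I • ((∏ j, eta (K j)) * taylorCoeff I f) =
        ∑ c : Γ.E → Fin m, if (fun e : Γ.SourceEdge => c e.1) = K then
          if (fun e : Γ.SinkEdge => c e.1) = I then
            (∏ v, P.vertexTensor x Γ c v) • ((∏ j, eta (K j)) * taylorCoeff I f) else 0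
          else 0 := by
      intro K I
      rw [rawTensor, Finset.sum_smul]
      refine Finset.sum_congr rfl fun c _ => ?_
      simp only [← funext_iff, ite_and, ite_smul, zero_smul]
    calc _ = ∑ K : Γ.SourceEdge → Fin m, ∑ I : Γ.SinkEdge → Fin m,
        P.rawTensor x Γ K I • ((∏ j, eta (K j)) * taylorCoeff I f) := by
          refine Fintype.sum_equiv (σ.symm.arrowCongr (Equiv.refl _)) _ _ fun K => ?_
          refine Fintype.sum_equiv (τ.symm.arrowCongr (Equiv.refl _)) _ _ fun I => ?_
          have hK : σ.symm.arrowCongr (Equiv.refl (Fin m)) K = K ∘ σ := rfl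
          have hI : τ.symm.arrowCongr (Equiv.refl (Fin m)) I = I ∘ τ := rfl
          rw [hK, hI, derivAtZero_eq, taylorCoeff_comp]
          congr 2
          exact (σ.prod_comp fun j => (eta (K j) : FockSpace m)).symm
      _ = ∑ c : Γ.E → Fin m, ∑ K : Γ.SourceEdge → Fin m,
          if (fun e : Γ.SourceEdge => c e.1) = K then ∑ I : Γ.SinkEdge → Fin m,
            if (fun e : Γ.SinkEdge => c e.1) = I then
              (∏ v, P.vertexTensor x Γ c v) • ((∏ j, eta (K j)) * taylorCoeff I f) else 0
          else 0 := by
          simp only [h1]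
          rw [Finset.sum_comm]
          rw [Finset.sum_congr rfl fun I _ => Finset.sum_comm, Finset.sum_comm]
          refine Finset.sum_congr rfl fun c _ => ?_
          rw [Finset.sum_comm]
          refine Finset.sum_congr rfl fun K _ => ?_
          split_ifs with h
          · rfl
          · simp
      _ = _ := by
          refine Finset.sum_congr rfl fun c _ => ?_
          rw [Finset.sum_ite_eq, if_pos (Finset.mem_univ _), Finset.sum_ite_eq,
            if_pos (Finset.mem_univ _), colorTerm]
  have hne : (Γ.sourceDegree.factorial : ℂ) * Γ.sinkDegree.factorial ≠ 0 :=
    mul_ne_zero (Nat.cast_ne_zero.2 (Nat.factorial_ne_zero _))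
      (Nat.cast_ne_zero.2 (Nat.factorial_ne_zero _))
  rw [partitionOperator, operatorOfMatrix, LinearMap.smul_apply]
  congr 1
  simp only [LinearMap.sum_apply, LinearMap.smul_apply, LinearMap.comp_apply,
    LinearMap.mulLeft_apply, graphTensor, mul_smul, Finset.sum_smul]
  simp only [← Finset.smul_sum]
  rw [inv_smul_eq_iff₀ hne]
  have hswap : ∀ G : (Fin Γ.sourceDegree → Fin m) → (Fin Γ.sinkDegree → Fin m) →
      (Γ.SourceEdge ≃ Fin Γ.sourceDegree) → (Γ.SinkEdge ≃ Fin Γ.sinkDegree) → FockSpace m,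
      ∑ K, ∑ I, ∑ σ, ∑ τ, G K I σ τ = ∑ σ, ∑ τ, ∑ K, ∑ I, G K I σ τ := by
    intro G
    calc _ = ∑ K, ∑ σ, ∑ I, ∑ τ, G K I σ τ := Finset.sum_congr rfl fun _ _ => Finset.sum_comm
      _ = ∑ σ, ∑ K, ∑ τ, ∑ I, G K I σ τ := by
        rw [Finset.sum_comm]
        exact Finset.sum_congr rfl fun _ _ => Finset.sum_congr rfl fun _ _ => Finset.sum_comm
      _ = _ := Finset.sum_congr rfl fun _ _ => Finset.sum_comm
  rw [hswap]
  simp only [key, Finset.sum_const, Finset.card_univ, hσ, hτ]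
  rw [← Nat.cast_smul_eq_nsmul ℂ, ← Nat.cast_smul_eq_nsmul ℂ, mul_smul]

theorem partitionOperator_congr {Γ Δ : Graph} (φ : Graph.Iso Γ Δ) :
    P.partitionOperator x Γ = P.partitionOperator x Δ := by
  classical
  have hV : ∀ (a : Option Γ.V) v, a.map φ.onV = some (φ.onV v) ↔ a = some v := fun a v => by
    rw [← Option.map_some, (Option.map_injective φ.onV.injective).eq_iff]
  let eo : ∀ v, Γ.OutEdge v ≃ Δ.OutEdge (φ.onV v) := fun v =>
    φ.onE.subtypeEquiv fun e => by rw [φ.tail_comp, hV]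
  let ei : ∀ v, {e // Γ.head e = some v} ≃ {e // Δ.head e = some (φ.onV v)} := fun v =>
    φ.onE.subtypeEquiv fun e => by rw [φ.head_comp, hV]
  let es : Γ.SourceEdge ≃ Δ.SourceEdge := φ.onE.subtypeEquiv fun e => by
    rw [φ.tail_comp, Option.map_eq_none_iff]
  let et : Γ.SinkEdge ≃ Δ.SinkEdge := φ.onE.subtypeEquiv fun e => by
    rw [φ.head_comp, Option.map_eq_none_iff]
  have hp : Γ.sinkDegree = Δ.sinkDegree := Nat.card_congr et
  ext1 f
  rw [partitionOperator_apply, partitionOperator_apply, hp]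
  congr 1
  refine Fintype.sum_equiv (φ.onE.arrowCongr (Equiv.refl _)) _ _ fun c => ?_
  have hc : ∀ e, (φ.onE.arrowCongr (Equiv.refl (Fin m))) c (φ.onE e) = c e := fun e => by simp
  congr 1
  · refine Fintype.prod_equiv φ.onV _ _ fun v => ?_
    exact Graph.vertexTensor_congr P x (φ.weight_comp v).symm (eo v) (fun e => hc e.1) (ei v)
      fun e => hc e.1
  · rw [colorTerm, colorTerm]
    congr 1
    · exact Fintype.prod_equiv es _ _ fun e => by rw [← hc e.1]; rfl
    · rw [← taylorCoeff_comp _ et]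
      congr 2
      funext e
      exact (hc e.1).symm

end FormalPotential

end PartitionOperators

end

noncomputable section

/-! ### Gluing the sink of one graph to the source of another. -/

namespace PartitionOperators

namespace Graph

/-- The maps `i₁`, `i₂` of the internal vertices and `j₁`, `j₂` of the edges exhibit the directed
multigraph with the vertices `V` and the edges `E` as the result of connecting the loose edges at
the sink of `Γ₁` with the loose edges at the source of `Γ₂`. -/
structure IsGluing (Γ₁ Γ₂ : Graph) {V E : Type} (tail head : E → Option V)
    (i₁ : Γ₁.V → V) (i₂ : Γ₂.V → V) (j₁ : Γ₁.E → E) (j₂ : Γ₂.E → E) : Prop where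
  i₁_inj : Function.Injective i₁
  i₂_inj : Function.Injective i₂
  i_ne : ∀ v w, i₁ v ≠ i₂ w
  i_cover : ∀ u, (∃ v, i₁ v = u) ∨ ∃ w, i₂ w = u
  j₁_inj : Function.Injective j₁
  j₂_inj : Function.Injective j₂
  j_cover : ∀ e, (∃ a, j₁ a = e) ∨ ∃ b, j₂ b = e
  tail₁ : ∀ e, tail (j₁ e) = (Γ₁.tail e).map i₁
  head₂ : ∀ e, head (j₂ e) = (Γ₂.head e).map i₂
  head₁ : ∀ e v, Γ₁.head e = some v → head (j₁ e) = some (i₁ v)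
  tail₂ : ∀ e v, Γ₂.tail e = some v → tail (j₂ e) = some (i₂ v)
  overlap₁ : ∀ a, Γ₁.head a = none → ∃ b, j₂ b = j₁ a
  overlap₂ : ∀ b, Γ₂.tail b = none → ∃ a, j₁ a = j₂ b

namespace IsGluing

variable {Γ₁ Γ₂ : Graph} {V E : Type} {tail head : E → Option V}
  {i₁ : Γ₁.V → V} {i₂ : Γ₂.V → V} {j₁ : Γ₁.E → E} {j₂ : Γ₂.E → E}
  (h : IsGluing Γ₁ Γ₂ tail head i₁ i₂ j₁ j₂)

include h

theorem map_ne (a : Option Γ₁.V) (w : Γ₂.V) : a.map i₁ ≠ some (i₂ w) := by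
  cases a with
  | none => simp
  | some v => simpa using h.i_ne v w

theorem map_ne' (b : Option Γ₂.V) (v : Γ₁.V) : b.map i₂ ≠ some (i₁ v) := by
  cases b with
  | none => simp
  | some w => simpa using (h.i_ne v w).symm

theorem head₁_eq_none {a : Γ₁.E} {b : Γ₂.E} (hab : j₁ a = j₂ b) : Γ₁.head a = none := by
  cases ha : Γ₁.head a with
  | none => rfl
  | some v =>
    have h1 := h.head₁ a v ha
    rw [hab, h.head₂] at h1
    exact (h.map_ne' _ _ h1).elim

theorem tail₂_eq_none {a : Γ₁.E} {b : Γ₂.E} (hab : j₁ a = j₂ b) : Γ₂.tail b = none := by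
  cases hb : Γ₂.tail b with
  | none => rfl
  | some w =>
    have h1 := h.tail₂ b w hb
    rw [← hab, h.tail₁] at h1
    exact (h.map_ne _ _ h1).elim

theorem head_j₁_iff (a : Γ₁.E) (v : Γ₁.V) : head (j₁ a) = some (i₁ v) ↔ Γ₁.head a = some v := by
  refine ⟨fun h1 => ?_, h.head₁ a v⟩
  cases ha : Γ₁.head a with
  | none =>
    obtain ⟨b, hb⟩ := h.overlap₁ a ha
    rw [← hb, h.head₂] at h1
    exact (h.map_ne' _ _ h1).elim
  | some w =>
    rw [h.head₁ a w ha, Option.some.injEq] at h1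
    rw [h.i₁_inj h1]

theorem tail_j₂_iff (b : Γ₂.E) (w : Γ₂.V) : tail (j₂ b) = some (i₂ w) ↔ Γ₂.tail b = some w := by
  refine ⟨fun h1 => ?_, h.tail₂ b w⟩
  cases hb : Γ₂.tail b with
  | none =>
    obtain ⟨a, ha⟩ := h.overlap₂ b hb
    rw [← ha, h.tail₁] at h1
    exact (h.map_ne _ _ h1).elim
  | some u =>
    rw [h.tail₂ b u hb, Option.some.injEq] at h1
    rw [h.i₂_inj h1]

theorem tail_j₁_iff (a : Γ₁.E) (v : Γ₁.V) : tail (j₁ a) = some (i₁ v) ↔ Γ₁.tail a = some v := by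
  rw [h.tail₁, ← Option.map_some, (Option.map_injective h.i₁_inj).eq_iff]

theorem head_j₂_iff (b : Γ₂.E) (w : Γ₂.V) : head (j₂ b) = some (i₂ w) ↔ Γ₂.head b = some w := by
  rw [h.head₂, ← Option.map_some, (Option.map_injective h.i₂_inj).eq_iff]

theorem exists_j₁_of_head {e : E} {v : Γ₁.V} (he : head e = some (i₁ v)) : ∃ a, j₁ a = e := by
  rcases h.j_cover e with ha | ⟨b, rfl⟩
  · exact ha
  · rw [h.head₂] at he
    exact (h.map_ne' _ _ he).elim

theorem exists_j₂_of_tail {e : E} {w : Γ₂.V} (he : tail e = some (i₂ w)) : ∃ b, j₂ b = e := by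
  rcases h.j_cover e with ⟨a, rfl⟩ | hb
  · rw [h.tail₁] at he
    exact (h.map_ne _ _ he).elim
  · exact hb

theorem exists_j₁_of_tail {e : E} (he : ∀ w, tail e ≠ some (i₂ w)) : ∃ a, j₁ a = e := by
  rcases h.j_cover e with ha | ⟨b, rfl⟩
  · exact ha
  · refine h.overlap₂ b (Option.eq_none_iff_forall_ne_some.2 fun w hw => he w (h.tail₂ b w hw))

theorem exists_j₂_of_head {e : E} (he : ∀ v, head e ≠ some (i₁ v)) : ∃ b, j₂ b = e := by
  rcases h.j_cover e with ⟨a, rfl⟩ | hb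
  · refine h.overlap₁ a (Option.eq_none_iff_forall_ne_some.2 fun v hv => he v (h.head₁ a v hv))
  · exact hb

omit h in
/-- A bijection of subtypes induced by an injective map. -/
theorem subtypeMap_bijective {α β : Type} {p : α → Prop} {q : β → Prop} {j : α → β}
    (hj : Function.Injective j) (hpq : ∀ a, p a → q (j a))
    (hs : ∀ b, q b → ∃ a, p a ∧ j a = b) :
    Function.Bijective (fun a : {a // p a} => (⟨j a.1, hpq a.1 a.2⟩ : {b // q b})) := by
  refine ⟨fun a b hab => Subtype.ext (hj (congrArg Subtype.val hab)), fun b => ?_⟩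
  obtain ⟨a, ha, hab⟩ := hs b.1 b.2
  exact ⟨⟨a, ha⟩, Subtype.ext hab⟩

def inEquiv₁ (v : Γ₁.V) : {a // Γ₁.head a = some v} ≃ {e // head e = some (i₁ v)} :=
  Equiv.ofBijective _ (subtypeMap_bijective h.j₁_inj (fun a => (h.head_j₁_iff a v).2) fun e he => by
    obtain ⟨a, rfl⟩ := h.exists_j₁_of_head he
    exact ⟨a, (h.head_j₁_iff a v).1 he, rfl⟩)

def outEquiv₁ (v : Γ₁.V) : Γ₁.OutEdge v ≃ {e // tail e = some (i₁ v)} :=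
  Equiv.ofBijective _ (subtypeMap_bijective h.j₁_inj (fun a => (h.tail_j₁_iff a v).2) fun e he => by
    obtain ⟨a, rfl⟩ := h.exists_j₁_of_tail (e := e) fun w hw =>
      h.i_ne v w (Option.some_injective _ (he.symm.trans hw))
    exact ⟨a, (h.tail_j₁_iff a v).1 he, rfl⟩)

def inEquiv₂ (w : Γ₂.V) : {b // Γ₂.head b = some w} ≃ {e // head e = some (i₂ w)} :=
  Equiv.ofBijective _ (subtypeMap_bijective h.j₂_inj (fun a => (h.head_j₂_iff a w).2) fun e he => by
    obtain ⟨a, rfl⟩ := h.exists_j₂_of_head (e := e) fun v hv =>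
      h.i_ne v w (Option.some_injective _ (hv.symm.trans he))
    exact ⟨a, (h.head_j₂_iff a w).1 he, rfl⟩)

def outEquiv₂ (w : Γ₂.V) : Γ₂.OutEdge w ≃ {e // tail e = some (i₂ w)} :=
  Equiv.ofBijective _ (subtypeMap_bijective h.j₂_inj (fun a => (h.tail_j₂_iff a w).2) fun e he => by
    obtain ⟨a, rfl⟩ := h.exists_j₂_of_tail he
    exact ⟨a, (h.tail_j₂_iff a w).1 he, rfl⟩)

def sourceEquiv : Γ₁.SourceEdge ≃ {e // tail e = none} :=
  Equiv.ofBijective _ (subtypeMap_bijective h.j₁_inj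
    (fun a ha => by rw [h.tail₁, ha, Option.map_none]) fun e he => by
    obtain ⟨a, rfl⟩ := h.exists_j₁_of_tail (e := e) fun w hw => by
      rw [he] at hw; exact absurd hw (by simp)
    rw [h.tail₁, Option.map_eq_none_iff] at he
    exact ⟨a, he, rfl⟩)

def sinkEquiv : Γ₂.SinkEdge ≃ {e // head e = none} :=
  Equiv.ofBijective _ (subtypeMap_bijective h.j₂_inj
    (fun a ha => by rw [h.head₂, ha, Option.map_none]) fun e he => by
    obtain ⟨a, rfl⟩ := h.exists_j₂_of_head (e := e) fun w hw => by
      rw [he] at hw; exact absurd hw (by simp)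
    rw [h.head₂, Option.map_eq_none_iff] at he
    exact ⟨a, he, rfl⟩)

theorem vertex_bijective : Function.Bijective (Sum.elim i₁ i₂) := by
  refine ⟨?_, fun u => ?_⟩
  · rintro (v | v) (w | w) hvw
    · exact congrArg _ (h.i₁_inj hvw)
    · exact (h.i_ne _ _ hvw).elim
    · exact (h.i_ne _ _ hvw.symm).elim
    · exact congrArg _ (h.i₂_inj hvw)
  · rcases h.i_cover u with ⟨v, hv⟩ | ⟨w, hw⟩
    · exact ⟨Sum.inl v, hv⟩
    · exact ⟨Sum.inr w, hw⟩

/-- No edge leads from a vertex of `Γ₂` to one of `Γ₁`. Hence a path ending in `Γ₁` lies in `Γ₁`, a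
path starting in `Γ₂` lies in `Γ₂`, and a cycle would already exist in one of the parts. -/
theorem acyclic : ∀ u, ¬ Relation.TransGen (fun a b => ∃ e, tail e = some a ∧ head e = some b) u u := by
  have step₁ : ∀ u v, (∃ e, tail e = some u ∧ head e = some (i₁ v)) →
      ∃ v', i₁ v' = u ∧ ∃ e, Γ₁.tail e = some v' ∧ Γ₁.head e = some v := by
    rintro u v ⟨e, h1, h2⟩
    obtain ⟨a, rfl⟩ := h.exists_j₁_of_head h2
    rw [h.tail₁, Option.map_eq_some_iff] at h1
    obtain ⟨v', hv', rfl⟩ := h1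
    exact ⟨v', rfl, a, hv', (h.head_j₁_iff a v).1 h2⟩
  have step₂ : ∀ w u, (∃ e, tail e = some (i₂ w) ∧ head e = some u) →
      ∃ w', i₂ w' = u ∧ ∃ e, Γ₂.tail e = some w ∧ Γ₂.head e = some w' := by
    rintro w u ⟨e, h1, h2⟩
    obtain ⟨b, rfl⟩ := h.exists_j₂_of_tail h1
    rw [h.head₂, Option.map_eq_some_iff] at h2
    obtain ⟨w', hw', rfl⟩ := h2
    exact ⟨w', rfl, b, (h.tail_j₂_iff b w).1 h1, hw'⟩
  intro u hu
  rcases h.i_cover u with ⟨v, rfl⟩ | ⟨w, rfl⟩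
  · have key : ∀ u, Relation.TransGen (fun a b => ∃ e, tail e = some a ∧ head e = some b) u (i₁ v) →
        ∃ v', i₁ v' = u ∧ Relation.TransGen
          (fun a b => ∃ e, Γ₁.tail e = some a ∧ Γ₁.head e = some b) v' v := by
      intro u hu
      induction hu using Relation.TransGen.head_induction_on with
      | single h1 =>
        obtain ⟨v', hv', he⟩ := step₁ _ _ h1
        exact ⟨v', hv', .single he⟩
      | head h1 _ ih =>
        obtain ⟨v', rfl, hv'⟩ := ih
        obtain ⟨v'', hv'', he⟩ := step₁ _ _ h1
        exact ⟨v'', hv'', .head he hv'⟩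
    obtain ⟨v', hv', hc⟩ := key _ hu
    rw [h.i₁_inj hv'] at hc
    exact Γ₁.acyclic v hc
  · have key : ∀ u, Relation.TransGen (fun a b => ∃ e, tail e = some a ∧ head e = some b) (i₂ w) u →
        ∃ w', i₂ w' = u ∧ Relation.TransGen
          (fun a b => ∃ e, Γ₂.tail e = some a ∧ Γ₂.head e = some b) w w' := by
      intro u hu
      induction hu with
      | single h1 =>
        obtain ⟨w', hw', he⟩ := step₂ _ _ h1
        exact ⟨w', hw', .single he⟩
      | tail _ h1 ih =>
        obtain ⟨w', rfl, hw'⟩ := ih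
        obtain ⟨w'', hw'', he⟩ := step₂ _ _ h1
        exact ⟨w'', hw'', .tail hw' he⟩
    obtain ⟨w', hw', hc⟩ := key _ hu
    rw [h.i₂_inj hw'] at hc
    exact Γ₂.acyclic w hc

end IsGluing

section glue

variable (Γ₁ Γ₂ : Graph) (σ : Γ₁.SinkEdge ≃ Γ₂.SourceEdge)

/-- A joined edge is represented by its half in `Γ₁`; hence the source edges of `Γ₂` are left out.
-/
abbrev GlueE : Type := Γ₁.E ⊕ {b // Γ₂.tail b ≠ none}

variable {Γ₁ Γ₂}

open Classical in
def glueHead (e : GlueE Γ₁ Γ₂) : Option (Γ₁.V ⊕ Γ₂.V) :=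
  Sum.elim (fun a => if h : Γ₁.head a = none then (Γ₂.head (σ ⟨a, h⟩).1).map Sum.inr
    else (Γ₁.head a).map Sum.inl) (fun b => (Γ₂.head b.1).map Sum.inr) e

def glueTail (e : GlueE Γ₁ Γ₂) : Option (Γ₁.V ⊕ Γ₂.V) :=
  Sum.elim (fun a => (Γ₁.tail a).map Sum.inl) (fun b => (Γ₂.tail b.1).map Sum.inr) e

open Classical in
def glueInr (b : Γ₂.E) : GlueE Γ₁ Γ₂ :=
  if h : Γ₂.tail b = none then Sum.inl (σ.symm ⟨b, h⟩).1 else Sum.inr ⟨b, h⟩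

theorem glueInr_of_none {b : Γ₂.E} (h : Γ₂.tail b = none) :
    glueInr σ b = Sum.inl (σ.symm ⟨b, h⟩).1 := dif_pos h

theorem glueInr_of_ne {b : Γ₂.E} (h : Γ₂.tail b ≠ none) : glueInr σ b = Sum.inr ⟨b, h⟩ := dif_neg h

theorem glueInr_apply (a : Γ₁.SinkEdge) : glueInr σ (σ a).1 = Sum.inl a.1 := by
  rw [glueInr_of_none σ (σ a).2]
  simp

theorem isGluing_glue :
    IsGluing Γ₁ Γ₂ glueTail (glueHead σ) Sum.inl Sum.inr Sum.inl (glueInr σ) where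
  i₁_inj := Sum.inl_injective
  i₂_inj := Sum.inr_injective
  i_ne v w := by simp
  i_cover u := by cases u <;> simp
  j₁_inj := Sum.inl_injective
  j₂_inj b b' hb := by
    by_cases h : Γ₂.tail b = none <;> by_cases h' : Γ₂.tail b' = none
    · rw [glueInr_of_none σ h, glueInr_of_none σ h', Sum.inl.injEq] at hb
      have := σ.symm.injective (Subtype.ext hb)
      exact congrArg Subtype.val this
    · rw [glueInr_of_none σ h, glueInr_of_ne σ h'] at hb
      simp at hb
    · rw [glueInr_of_ne σ h, glueInr_of_none σ h'] at hb
      simp at hb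
    · rw [glueInr_of_ne σ h, glueInr_of_ne σ h', Sum.inr.injEq] at hb
      exact congrArg Subtype.val hb
  j_cover e := by
    rcases e with a | b
    · exact Or.inl ⟨a, rfl⟩
    · exact Or.inr ⟨b.1, glueInr_of_ne σ b.2⟩
  tail₁ _ := rfl
  head₂ b := by
    by_cases h : Γ₂.tail b = none
    · rw [glueInr_of_none σ h]
      simp [glueHead, (σ.symm ⟨b, h⟩).2]
    · rw [glueInr_of_ne σ h]
      rfl
  head₁ a v h := by simp [glueHead, h]
  tail₂ b w h := by
    rw [glueInr_of_ne σ (by simp [h])]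
    simp [glueTail, h]
  overlap₁ a h := ⟨(σ ⟨a, h⟩).1, glueInr_apply σ ⟨a, h⟩⟩
  overlap₂ b h := ⟨_, (glueInr_of_none σ h).symm⟩

open Classical in
/-- The graph obtained by connecting the edges entering the sink of `Γ₁` with the edges leaving the
source of `Γ₂` as prescribed by `σ`. -/
def glue : Graph where
  V := Γ₁.V ⊕ Γ₂.V
  E := GlueE Γ₁ Γ₂
  tail := glueTail
  head := glueHead σ
  weight := Sum.elim Γ₁.weight Γ₂.weight
  one_le_in v := by
    have h := isGluing_glue σ
    rcases v with v | v
    · rw [← Nat.card_congr (h.inEquiv₁ v)]; exact Γ₁.one_le_in v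
    · rw [← Nat.card_congr (h.inEquiv₂ v)]; exact Γ₂.one_le_in v
  one_le_out v := by
    have h := isGluing_glue σ
    rcases v with v | v
    · rw [← Nat.card_congr (h.outEquiv₁ v)]; exact Γ₁.one_le_out v
    · rw [← Nat.card_congr (h.outEquiv₂ v)]; exact Γ₂.one_le_out v
  neg_one_le_weight v := by
    rcases v with v | v
    · exact Γ₁.neg_one_le_weight v
    · exact Γ₂.neg_one_le_weight v
  two_le v := by
    have h := isGluing_glue σ
    rcases v with v | v
    · rw [← Nat.card_congr (h.inEquiv₁ v), ← Nat.card_congr (h.outEquiv₁ v)]; exact Γ₁.two_le v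
    · rw [← Nat.card_congr (h.inEquiv₂ v), ← Nat.card_congr (h.outEquiv₂ v)]; exact Γ₂.two_le v
  acyclic := (isGluing_glue σ).acyclic

theorem isGluing_glue' : IsGluing Γ₁ Γ₂ (glue σ).tail (glue σ).head Sum.inl Sum.inr Sum.inl
    (glueInr σ) := isGluing_glue σ

theorem opWeight_glue : (glue σ).opWeight = Γ₁.opWeight + Γ₂.opWeight := by
  have h := isGluing_glue' σ
  have h1 : ∀ v, (glue σ).outDegree (Sum.inl v) = Γ₁.outDegree v := fun v =>
    (Nat.card_congr (h.outEquiv₁ v)).symm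
  have h2 : ∀ v, (glue σ).outDegree (Sum.inr v) = Γ₂.outDegree v := fun v =>
    (Nat.card_congr (h.outEquiv₂ v)).symm
  unfold opWeight
  refine (Fintype.sum_sum_type (α₁ := Γ₁.V) (α₂ := Γ₂.V) _).trans ?_
  simp only [h1, h2]
  rfl

theorem sinkDegree_glue : (glue σ).sinkDegree = Γ₂.sinkDegree :=
  (Nat.card_congr (isGluing_glue' σ).sinkEquiv).symm

end glue

end Graph

namespace FormalPotential

open FockSpace PartitionOperators.Graph

variable {m : ℕ} (P : FormalPotential m) (x : Fin m → ℂ) {Γ₁ Γ₂ : Graph}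

/-- The colourings of a glued graph are the pairs of compatible colourings of its parts. -/
def glueColor (σ : Γ₁.SinkEdge ≃ Γ₂.SourceEdge) :
    {c : (Γ₁.E → Fin m) × (Γ₂.E → Fin m) // ∀ s, c.2 (σ s).1 = c.1 s.1} ≃
      ((glue σ).E → Fin m) where
  toFun c := Sum.elim c.1.1 fun b => c.1.2 b.1
  invFun c := ⟨⟨fun a => c (Sum.inl a), fun b => c (glueInr σ b)⟩, fun s => by
    simp only [glueInr_apply]⟩
  left_inv c := by
    refine Subtype.ext (Prod.ext rfl (funext fun b => ?_))
    by_cases h : Γ₂.tail b = none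
    · have := c.2 (σ.symm ⟨b, h⟩)
      simp only [glueInr_of_none σ h, Sum.elim_inl, ← this, Equiv.apply_symm_apply]
    · simp only [glueInr_of_ne σ h, Sum.elim_inr]
  right_inv c := by
    funext e
    rcases e with a | b
    · rfl
    · exact congrArg c (glueInr_of_ne σ b.2)

theorem glueColor_inr {σ : Γ₁.SinkEdge ≃ Γ₂.SourceEdge}
    (c : {c : (Γ₁.E → Fin m) × (Γ₂.E → Fin m) // ∀ s, c.2 (σ s).1 = c.1 s.1}) (b : Γ₂.E) :
    glueColor σ c (glueInr σ b) = c.1.2 b :=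
  congrFun (congrArg (fun c => c.1.2) ((glueColor σ).symm_apply_apply c)) b

theorem prod_vertexTensor_glue {σ : Γ₁.SinkEdge ≃ Γ₂.SourceEdge}
    (c : {c : (Γ₁.E → Fin m) × (Γ₂.E → Fin m) // ∀ s, c.2 (σ s).1 = c.1 s.1}) :
    ∏ v, P.vertexTensor x (glue σ) (glueColor σ c) v =
      (∏ v, P.vertexTensor x Γ₁ c.1.1 v) * ∏ v, P.vertexTensor x Γ₂ c.1.2 v := by
  have h := isGluing_glue' σ
  refine (Fintype.prod_sum_type (α₁ := Γ₁.V) (α₂ := Γ₂.V) _).trans ?_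
  congr 1
  · exact Finset.prod_congr rfl fun v _ => (vertexTensor_congr P x (Γ := Γ₁) (Δ := glue σ)
      (c := c.1.1) (d := glueColor σ c) (w := Sum.inl v) rfl (h.outEquiv₁ v)
      (fun e => rfl) (h.inEquiv₁ v) fun e => rfl).symm
  · exact Finset.prod_congr rfl fun v _ => (vertexTensor_congr P x (Γ := Γ₂) (Δ := glue σ)
      (c := c.1.2) (d := glueColor σ c) (w := Sum.inr v) rfl (h.outEquiv₂ v)
      (fun e => glueColor_inr c e.1) (h.inEquiv₂ v) fun e => glueColor_inr c e.1).symm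

open Classical in
theorem colorTerm_glue {σ : Γ₁.SinkEdge ≃ Γ₂.SourceEdge}
    (c : {c : (Γ₁.E → Fin m) × (Γ₂.E → Fin m) // ∀ s, c.2 (σ s).1 = c.1 s.1}) (f : FockSpace m) :
    colorTerm (glue σ) (glueColor σ c) f = (∏ e : Γ₁.SourceEdge, eta (c.1.1 e.1)) *
      taylorCoeff (fun e : Γ₂.SinkEdge => c.1.2 e.1) f := by
  have h := isGluing_glue' σ
  rw [colorTerm]
  congr 1
  · exact (Fintype.prod_equiv h.sourceEquiv _ _ fun e => rfl).symm
  · rw [← taylorCoeff_comp _ h.sinkEquiv]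
    congr 2
    funext e
    exact glueColor_inr c e.1

open Classical in
/-- The composition of partition operators is a sum over the gluings of the graphs. -/
theorem partitionOperator_comp (f : FockSpace m) :
    P.partitionOperator x Γ₁ (P.partitionOperator x Γ₂ f) = (Γ₁.sinkDegree.factorial : ℂ)⁻¹ •
      ∑ σ : Γ₁.SinkEdge ≃ Γ₂.SourceEdge, P.partitionOperator x (glue σ) f := by
  -- The number of index-preserving bijections is written as a sum of indicators over all `σ`, so
  -- that `σ` can be summed last.
  have hterm : ∀ (c₁ : Γ₁.E → Fin m) (c₂ : Γ₂.E → Fin m),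
      colorTerm Γ₁ c₁ (colorTerm Γ₂ c₂ f) =
        ∑ σ : Γ₁.SinkEdge ≃ Γ₂.SourceEdge, if ∀ s, c₂ (σ s).1 = c₁ s.1 then
          (∏ e : Γ₁.SourceEdge, eta (c₁ e.1)) * taylorCoeff (fun e : Γ₂.SinkEdge => c₂ e.1) f
        else 0 := by
    intro c₁ c₂
    rw [colorTerm, colorTerm, taylorCoeff_prod_eta_mul, ← Finset.sum_filter, Finset.sum_const,
      Nat.card_eq_fintype_card, Fintype.card_subtype, mul_smul_comm, Nat.cast_smul_eq_nsmul]
  rw [partitionOperator_apply P x Γ₁, partitionOperator_apply P x Γ₂]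
  congr 1
  have hlin : ∀ c : Γ₁.E → Fin m, ∀ (a : ℂ) (s : Finset (Γ₂.E → Fin m)) (g : (Γ₂.E → Fin m) → FockSpace m),
      colorTerm Γ₁ c (a • ∑ d ∈ s, g d) = a • ∑ d ∈ s, colorTerm Γ₁ c (g d) := by
    intro c a s g
    simp only [colorTerm, map_smul, map_sum, Finset.mul_sum, mul_smul_comm, Finset.smul_sum]
  have hsm : ∀ c : Γ₁.E → Fin m, ∀ (a : ℂ) (g : FockSpace m),
      colorTerm Γ₁ c (a • g) = a • colorTerm Γ₁ c g := by
    intro c a g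
    simp only [colorTerm, map_smul, mul_smul_comm]
  simp only [hlin, hsm, hterm]
  have hσ : ∀ σ : Γ₁.SinkEdge ≃ Γ₂.SourceEdge, P.partitionOperator x (glue σ) f =
      (Γ₂.sinkDegree.factorial : ℂ)⁻¹ • ∑ c₁ : Γ₁.E → Fin m, ∑ c₂ : Γ₂.E → Fin m,
        if ∀ s, c₂ (σ s).1 = c₁ s.1 then
          ((∏ v, P.vertexTensor x Γ₁ c₁ v) * ∏ v, P.vertexTensor x Γ₂ c₂ v) •
          ((∏ e : Γ₁.SourceEdge, eta (c₁ e.1)) * taylorCoeff (fun e : Γ₂.SinkEdge => c₂ e.1) f)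
        else 0 := by
    intro σ
    rw [partitionOperator_apply, sinkDegree_glue]
    congr 1
    -- For fixed `σ`, the pairs of colourings passing the indicator are the colourings of `glue σ`.
    rw [← Fintype.sum_equiv (glueColor σ) (fun c =>
      (∏ v, P.vertexTensor x (glue σ) (glueColor σ c) v) • colorTerm (glue σ) (glueColor σ c) f) _
      fun c => rfl, ← Fintype.sum_prod_type', ← Finset.sum_filter,
      Finset.sum_subtype (p := fun c : (Γ₁.E → Fin m) × (Γ₂.E → Fin m) =>
        ∀ s, c.2 (σ s).1 = c.1 s.1) _ (fun c => by simp)]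
    refine Finset.sum_congr rfl fun c _ => ?_
    rw [prod_vertexTensor_glue, colorTerm_glue]
  simp only [hσ]
  rw [← Finset.smul_sum]
  simp only [smul_comm _ ((Γ₂.sinkDegree.factorial : ℂ)⁻¹), ← Finset.smul_sum]
  congr 1
  rw [Finset.sum_comm]
  refine Finset.sum_congr rfl fun c₁ _ => ?_
  rw [Finset.sum_comm, Finset.smul_sum]
  refine Finset.sum_congr rfl fun c₂ _ => ?_
  rw [Finset.smul_sum, Finset.smul_sum]
  refine Finset.sum_congr rfl fun σ _ => ?_
  split_ifs
  · rw [mul_smul]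
  · simp

end FormalPotential

end PartitionOperators

end

noncomputable section

/-! ### Isomorphisms, cuts and the double counting of gluings. -/

namespace PartitionOperators

namespace Graph

theorem Iso.ext_apply {Γ Δ : Graph} {f g : Iso Γ Δ} (hV : ∀ v, f.onV v = g.onV v)
    (hE : ∀ e, f.onE e = g.onE e) : f = g := by
  cases f
  cases g
  obtain rfl := Equiv.ext hV
  obtain rfl := Equiv.ext hE
  rfl

instance (Γ Δ : Graph) : Finite (Iso Γ Δ) :=
  Finite.of_injective (fun f : Iso Γ Δ => (f.onV, f.onE)) fun _ _ h =>
    Iso.ext_apply (fun v => DFunLike.congr_fun (congrArg Prod.fst h) v)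
      fun e => DFunLike.congr_fun (congrArg Prod.snd h) e

theorem autCard_ne_zero (Γ : Graph) : Γ.autCard ≠ 0 :=
  Nat.card_ne_zero.2 ⟨⟨Iso.refl Γ⟩, inferInstance⟩

/-- The isomorphisms, once one exists, form a torsor under the automorphism group of either end. -/
theorem card_iso_left {Γ Δ : Graph} (f : Iso Γ Δ) : Nat.card (Iso Γ Δ) = Γ.autCard :=
  Nat.card_congr
    { toFun := fun g => g.trans f.symm
      invFun := fun g => g.trans f
      left_inv := fun _ => Iso.ext_apply (fun _ => f.onV.apply_symm_apply _)
        fun _ => f.onE.apply_symm_apply _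
      right_inv := fun _ => Iso.ext_apply (fun _ => f.onV.symm_apply_apply _)
        fun _ => f.onE.symm_apply_apply _ }

theorem card_iso_right {Γ Δ : Graph} (f : Iso Γ Δ) : Nat.card (Iso Γ Δ) = Δ.autCard :=
  Nat.card_congr
    { toFun := fun g => f.symm.trans g
      invFun := fun g => f.trans g
      left_inv := fun g => Iso.ext_apply (fun _ => congrArg g.onV (f.onV.symm_apply_apply _))
        fun _ => congrArg g.onE (f.onE.symm_apply_apply _)
      right_inv := fun g => Iso.ext_apply (fun _ => congrArg g.onV (f.onV.apply_symm_apply _))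
        fun _ => congrArg g.onE (f.onE.apply_symm_apply _) }

theorem sinkDegree_congr {Γ Δ : Graph} (f : Iso Γ Δ) : Γ.sinkDegree = Δ.sinkDegree :=
  Nat.card_congr (f.onE.subtypeEquiv fun e => by rw [f.head_comp, Option.map_eq_none_iff])

theorem opWeight_congr {Γ Δ : Graph} (f : Iso Γ Δ) : Γ.opWeight = Δ.opWeight := by
  refine Fintype.sum_equiv f.onV _ _ fun v => ?_
  rw [f.weight_comp]
  congr 3
  exact Nat.card_congr (f.onE.subtypeEquiv fun e => by
    rw [f.tail_comp, ← Option.map_some, (Option.map_injective f.onV.injective).eq_iff])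

theorem option_map_eq {A B : Type} (e : A ≃ B) {a : Option A} {b : Option B}
    (h : ∀ v, b = some (e v) ↔ a = some v) : b = a.map e := by
  cases a with
  | none =>
    refine Option.eq_none_iff_forall_ne_some.2 fun w hw => ?_
    have := (h (e.symm w)).1 (by simpa using hw)
    simp at this
  | some v => simpa using (h v).2 rfl

theorem IsGluing.precomp {Γ₁ Γ₂ Δ₁ Δ₂ : Graph} {V E : Type} {tail head : E → Option V}
    {i₁ : Δ₁.V → V} {i₂ : Δ₂.V → V} {j₁ : Δ₁.E → E} {j₂ : Δ₂.E → E}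
    (h : IsGluing Δ₁ Δ₂ tail head i₁ i₂ j₁ j₂) (f : Iso Γ₁ Δ₁) (g : Iso Γ₂ Δ₂) :
    IsGluing Γ₁ Γ₂ tail head (i₁ ∘ f.onV) (i₂ ∘ g.onV) (j₁ ∘ f.onE) (j₂ ∘ g.onE) where
  i₁_inj := h.i₁_inj.comp f.onV.injective
  i₂_inj := h.i₂_inj.comp g.onV.injective
  i_ne v w := h.i_ne _ _
  i_cover u := (h.i_cover u).imp (fun ⟨v, hv⟩ => ⟨f.onV.symm v, by simpa using hv⟩)
    fun ⟨v, hv⟩ => ⟨g.onV.symm v, by simpa using hv⟩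
  j₁_inj := h.j₁_inj.comp f.onE.injective
  j₂_inj := h.j₂_inj.comp g.onE.injective
  j_cover u := (h.j_cover u).imp (fun ⟨v, hv⟩ => ⟨f.onE.symm v, by simpa using hv⟩)
    fun ⟨v, hv⟩ => ⟨g.onE.symm v, by simpa using hv⟩
  tail₁ e := by rw [Function.comp_apply, h.tail₁, f.tail_comp, Option.map_map]
  head₂ e := by rw [Function.comp_apply, h.head₂, g.head_comp, Option.map_map]
  head₁ e v he := h.head₁ _ _ (by rw [f.head_comp, he, Option.map_some])
  tail₂ e v he := h.tail₂ _ _ (by rw [g.tail_comp, he, Option.map_some])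
  overlap₁ a ha := by
    obtain ⟨b, hb⟩ := h.overlap₁ (f.onE a) (by rw [f.head_comp, ha, Option.map_none])
    exact ⟨g.onE.symm b, by simpa using hb⟩
  overlap₂ b hb := by
    obtain ⟨a, ha⟩ := h.overlap₂ (g.onE b) (by rw [g.tail_comp, hb, Option.map_none])
    exact ⟨f.onE.symm a, by simpa using ha⟩

theorem IsGluing.postcomp {Γ₁ Γ₂ Γ Δ : Graph} {i₁ : Γ₁.V → Γ.V} {i₂ : Γ₂.V → Γ.V}
    {j₁ : Γ₁.E → Γ.E} {j₂ : Γ₂.E → Γ.E}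
    (h : IsGluing Γ₁ Γ₂ Γ.tail Γ.head i₁ i₂ j₁ j₂) (f : Iso Γ Δ) :
    IsGluing Γ₁ Γ₂ Δ.tail Δ.head (f.onV ∘ i₁) (f.onV ∘ i₂) (f.onE ∘ j₁) (f.onE ∘ j₂) where
  i₁_inj := f.onV.injective.comp h.i₁_inj
  i₂_inj := f.onV.injective.comp h.i₂_inj
  i_ne v w hvw := h.i_ne v w (f.onV.injective hvw)
  i_cover u := (h.i_cover (f.onV.symm u)).imp (fun ⟨v, hv⟩ => ⟨v, by simp [hv]⟩)
    fun ⟨v, hv⟩ => ⟨v, by simp [hv]⟩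
  j₁_inj := f.onE.injective.comp h.j₁_inj
  j₂_inj := f.onE.injective.comp h.j₂_inj
  j_cover u := (h.j_cover (f.onE.symm u)).imp (fun ⟨v, hv⟩ => ⟨v, by simp [hv]⟩)
    fun ⟨v, hv⟩ => ⟨v, by simp [hv]⟩
  tail₁ e := by rw [Function.comp_apply, f.tail_comp, h.tail₁, Option.map_map]
  head₂ e := by rw [Function.comp_apply, f.head_comp, h.head₂, Option.map_map]
  head₁ e v he := by rw [Function.comp_apply, f.head_comp, h.head₁ e v he]; rfl
  tail₂ e v he := by rw [Function.comp_apply, f.tail_comp, h.tail₂ e v he]; rfl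
  overlap₁ a ha := (h.overlap₁ a ha).imp fun b hb => congrArg f.onE hb
  overlap₂ b hb := (h.overlap₂ b hb).imp fun a ha => congrArg f.onE ha

section pieces

variable {Γ : Graph} (π : Γ.Cut)

def lowerV : (Γ.lowerPiece π).V → Γ.V := fun v : π.1 => v.1

def lowerE : (Γ.lowerPiece π).E → Γ.E := fun e : {e // Γ.TailLower π.1 e} => e.1

def upperV : (Γ.upperPiece π).V → Γ.V := fun v : (π.1ᶜ : Set Γ.V) => v.1

def upperE : (Γ.upperPiece π).E → Γ.E := fun e : {e // Γ.HeadUpper π.1 e} => e.1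

theorem map_restrict {V : Type} {S : Set V} {a : Option V} (h : ∀ v, a = some v → v ∈ S) :
    (restrict S a).map Subtype.val = a := by
  cases a with
  | none => rfl
  | some v => simp [restrict, h v rfl]

theorem restrict_eq_none {V : Type} {S : Set V} {a : Option V} :
    restrict S a = none ↔ ∀ v, a = some v → v ∉ S := by
  rw [Option.eq_none_iff_forall_ne_some]
  exact ⟨fun h v hv hS => h ⟨v, hS⟩ (restrict_eq_some.2 hv),
    fun h v hv => h v.1 (restrict_eq_some.1 hv) v.2⟩

/-- An edge crossing the cut occurs in both pieces, as a sink edge of the lower and as a source edge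
of the upper one. Admissibility says that every edge of `Γ` occurs in at least one piece. -/
theorem isGluing_pieces : IsGluing (Γ.lowerPiece π) (Γ.upperPiece π) Γ.tail Γ.head
    (lowerV π) (upperV π) (lowerE π) (upperE π) where
  i₁_inj := Subtype.val_injective
  i₂_inj := Subtype.val_injective
  i_ne v w hvw := by
    have h1 : lowerV π v ∈ π.1 := Subtype.prop (p := (· ∈ π.1)) v
    have h2 : upperV π w ∉ π.1 := Subtype.prop (p := (· ∉ π.1)) w
    exact h2 (hvw ▸ h1)
  i_cover u := by
    by_cases h : u ∈ π.1
    · exact Or.inl ⟨(⟨u, h⟩ : π.1), rfl⟩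
    · exact Or.inr ⟨(⟨u, h⟩ : (π.1ᶜ : Set Γ.V)), rfl⟩
  j₁_inj := Subtype.val_injective
  j₂_inj := Subtype.val_injective
  j_cover e := (π.2 e).imp (fun h => ⟨(⟨e, h⟩ : {e // Γ.TailLower π.1 e}), rfl⟩)
    fun h => ⟨(⟨e, h⟩ : {e // Γ.HeadUpper π.1 e}), rfl⟩
  tail₁ e := (map_restrict (Subtype.prop (p := Γ.TailLower π.1) e)).symm
  head₂ e := (map_restrict (Subtype.prop (p := Γ.HeadUpper π.1) e)).symm
  head₁ e v he := restrict_eq_some.1 he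
  tail₂ e v he := restrict_eq_some.1 he
  overlap₁ a ha := ⟨(⟨lowerE π a, restrict_eq_none.1 ha⟩ : {e // Γ.HeadUpper π.1 e}), rfl⟩
  overlap₂ b hb := ⟨(⟨upperE π b, fun v hv => not_not.1 (restrict_eq_none.1 hb v hv)⟩ :
    {e // Γ.TailLower π.1 e}), rfl⟩

theorem sinkDegree_lowerPiece : (Γ.lowerPiece π).sinkDegree = Γ.cutCard π := by
  refine (Nat.card_congr (Equiv.trans ?_ (Equiv.subtypeSubtypeEquivSubtypeInter _ _)))
  exact Equiv.subtypeEquivRight fun e => restrict_eq_none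

end pieces

/-- The ways to obtain `Γ` by connecting the sink of `Γ₁` with the source of `Γ₂`. -/
abbrev Gluing (Γ₁ Γ₂ Γ : Graph) : Type :=
  {t : ((Γ₁.V → Γ.V) × (Γ₂.V → Γ.V)) × ((Γ₁.E → Γ.E) × (Γ₂.E → Γ.E)) //
    IsGluing Γ₁ Γ₂ Γ.tail Γ.head t.1.1 t.1.2 t.2.1 t.2.2 ∧
      (∀ v, Γ.weight (t.1.1 v) = Γ₁.weight v) ∧ ∀ w, Γ.weight (t.1.2 w) = Γ₂.weight w}

variable {Γ₁ Γ₂ Γ : Graph}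

def gluingOfCut (y : Σ π : Γ.Cut, Iso Γ₁ (Γ.lowerPiece π) × Iso Γ₂ (Γ.upperPiece π)) :
    Gluing Γ₁ Γ₂ Γ :=
  ⟨((lowerV y.1 ∘ y.2.1.onV, upperV y.1 ∘ y.2.2.onV),
    (lowerE y.1 ∘ y.2.1.onE, upperE y.1 ∘ y.2.2.onE)),
    (isGluing_pieces y.1).precomp y.2.1 y.2.2, y.2.1.weight_comp, y.2.2.weight_comp⟩

theorem range_gluingOfCut
    (y : Σ π : Γ.Cut, Iso Γ₁ (Γ.lowerPiece π) × Iso Γ₂ (Γ.upperPiece π)) :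
    Set.range (gluingOfCut y).1.1.1 = y.1.1 := by
  change Set.range (lowerV y.1 ∘ y.2.1.onV) = _
  rw [EquivLike.range_comp]
  exact Subtype.range_val

/-- The cut is recovered as the image of the vertices of `Γ₁`; for a fixed cut the isomorphisms are
recovered since the pieces embed into `Γ`. -/
theorem gluingOfCut_injective : Function.Injective (gluingOfCut (Γ₁ := Γ₁) (Γ₂ := Γ₂) (Γ := Γ)) := by
  intro y y' h
  have hS : y.1 = y'.1 := Subtype.ext (by
    rw [← range_gluingOfCut y, h, range_gluingOfCut])
  obtain ⟨π, f, g⟩ := y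
  obtain ⟨π', f', g'⟩ := y'
  obtain rfl : π = π' := hS
  have h1 := congrArg Subtype.val h
  have hf : f = f' := Iso.ext_apply
    (fun v => Subtype.val_injective (congrFun (congrArg (fun t => t.1.1) h1) v))
    fun v => Subtype.val_injective (congrFun (congrArg (fun t => t.2.1) h1) v)
  have hg : g = g' := Iso.ext_apply
    (fun v => Subtype.val_injective (congrFun (congrArg (fun t => t.1.2) h1) v))
    fun v => Subtype.val_injective (congrFun (congrArg (fun t => t.2.2) h1) v)
  rw [hf, hg]

namespace IsGluing

variable {i₁ : Γ₁.V → Γ.V} {i₂ : Γ₂.V → Γ.V} {j₁ : Γ₁.E → Γ.E} {j₂ : Γ₂.E → Γ.E}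
  (h : IsGluing Γ₁ Γ₂ Γ.tail Γ.head i₁ i₂ j₁ j₂)

include h

theorem tailLower_iff (e : Γ.E) : Γ.TailLower (Set.range i₁) e ↔ ∃ a, j₁ a = e := by
  constructor
  · intro he
    refine h.exists_j₁_of_tail fun w hw => ?_
    obtain ⟨v, hv⟩ := he _ hw
    exact h.i_ne v w hv
  · rintro ⟨a, rfl⟩ v hv
    rw [h.tail₁, Option.map_eq_some_iff] at hv
    obtain ⟨v', -, hv'⟩ := hv
    exact ⟨v', hv'⟩

theorem headUpper_iff (e : Γ.E) : Γ.HeadUpper (Set.range i₁) e ↔ ∃ b, j₂ b = e := by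
  constructor
  · intro he
    exact h.exists_j₂_of_head fun v hv => he _ hv ⟨v, rfl⟩
  · rintro ⟨b, rfl⟩ v hv ⟨u, rfl⟩
    rw [h.head₂] at hv
    exact h.map_ne' _ _ hv

theorem compl_range (u : Γ.V) : u ∈ (Set.range i₁)ᶜ ↔ ∃ w, i₂ w = u := by
  constructor
  · intro hu
    exact (h.i_cover u).resolve_left hu
  · rintro ⟨w, rfl⟩ ⟨v, hv⟩
    exact h.i_ne v w hv

/-- The partition of the internal vertices of `Γ` into those of `Γ₁` and those of `Γ₂`. -/
def cut : Γ.Cut := ⟨Set.range i₁, fun e => by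
  rw [h.tailLower_iff, h.headUpper_iff]; exact h.j_cover e⟩

def lowerVEquiv : Γ₁.V ≃ (Set.range i₁) := Equiv.ofInjective i₁ h.i₁_inj

def upperVEquiv : Γ₂.V ≃ ((Set.range i₁)ᶜ : Set Γ.V) :=
  Equiv.ofBijective (fun w => ⟨i₂ w, (h.compl_range _).2 ⟨w, rfl⟩⟩)
    ⟨fun w w' hw => h.i₂_inj (congrArg Subtype.val hw), fun u => by
      obtain ⟨w, hw⟩ := (h.compl_range _).1 u.2
      exact ⟨w, Subtype.ext hw⟩⟩

def lowerEEquiv : Γ₁.E ≃ {e // Γ.TailLower (Set.range i₁) e} :=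
  Equiv.ofBijective (fun a => ⟨j₁ a, (h.tailLower_iff _).2 ⟨a, rfl⟩⟩)
    ⟨fun w w' hw => h.j₁_inj (congrArg Subtype.val hw), fun u => by
      obtain ⟨w, hw⟩ := (h.tailLower_iff _).1 u.2
      exact ⟨w, Subtype.ext hw⟩⟩

def upperEEquiv : Γ₂.E ≃ {e // Γ.HeadUpper (Set.range i₁) e} :=
  Equiv.ofBijective (fun a => ⟨j₂ a, (h.headUpper_iff _).2 ⟨a, rfl⟩⟩)
    ⟨fun w w' hw => h.j₂_inj (congrArg Subtype.val hw), fun u => by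
      obtain ⟨w, hw⟩ := (h.headUpper_iff _).1 u.2
      exact ⟨w, Subtype.ext hw⟩⟩

def isoLower (hw : ∀ v, Γ.weight (i₁ v) = Γ₁.weight v) : Iso Γ₁ (Γ.lowerPiece h.cut) where
  onV := h.lowerVEquiv
  onE := h.lowerEEquiv
  tail_comp a := option_map_eq h.lowerVEquiv fun v =>
    restrict_eq_some.trans (h.tail_j₁_iff a v)
  head_comp a := option_map_eq h.lowerVEquiv fun v =>
    restrict_eq_some.trans (h.head_j₁_iff a v)
  weight_comp := hw

def isoUpper (hw : ∀ v, Γ.weight (i₂ v) = Γ₂.weight v) : Iso Γ₂ (Γ.upperPiece h.cut) where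
  onV := h.upperVEquiv
  onE := h.upperEEquiv
  tail_comp a := option_map_eq h.upperVEquiv fun v =>
    restrict_eq_some.trans (h.tail_j₂_iff a v)
  head_comp a := option_map_eq h.upperVEquiv fun v =>
    restrict_eq_some.trans (h.head_j₂_iff a v)
  weight_comp := hw

/-- The bijection by which the loose edges of `Γ₁` and `Γ₂` are connected. -/
def matching : Γ₁.SinkEdge ≃ Γ₂.SourceEdge :=
  Equiv.ofBijective (fun a => ⟨(h.overlap₁ a.1 a.2).choose,
      h.tail₂_eq_none (h.overlap₁ a.1 a.2).choose_spec.symm⟩) ⟨fun a a' ha => by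
    refine Subtype.ext (h.j₁_inj ?_)
    rw [← (h.overlap₁ a.1 a.2).choose_spec, ← (h.overlap₁ a'.1 a'.2).choose_spec]
    exact congrArg (fun b => j₂ b.1) ha, fun b => by
    obtain ⟨a, ha⟩ := h.overlap₂ b.1 b.2
    refine ⟨⟨a, h.head₁_eq_none ha⟩, Subtype.ext (h.j₂_inj ?_)⟩
    rw [← ha]
    exact (h.overlap₁ a (h.head₁_eq_none ha)).choose_spec⟩

theorem j₂_matching (a : Γ₁.SinkEdge) : j₂ (h.matching a).1 = j₁ a.1 :=
  (h.overlap₁ a.1 a.2).choose_spec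

theorem edge_bijective :
    Function.Bijective (Sum.elim j₁ fun b : {b // Γ₂.tail b ≠ none} => j₂ b.1) := by
  refine ⟨?_, fun e => ?_⟩
  · rintro (a | b) (a' | b') hab
    · exact congrArg _ (h.j₁_inj hab)
    · exact (b'.2 (h.tail₂_eq_none hab)).elim
    · exact (b.2 (h.tail₂_eq_none hab.symm)).elim
    · exact congrArg _ (Subtype.ext (h.j₂_inj hab))
  · rcases h.j_cover e with ⟨a, ha⟩ | ⟨b, rfl⟩
    · exact ⟨Sum.inl a, ha⟩
    · by_cases hb : Γ₂.tail b = none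
      · obtain ⟨a, ha⟩ := h.overlap₂ b hb
        exact ⟨Sum.inl a, ha⟩
      · exact ⟨Sum.inr ⟨b, hb⟩, rfl⟩

/-- Every gluing is the standard one along the matching that it induces on loose edges. -/
def isoGlue (hw₁ : ∀ v, Γ.weight (i₁ v) = Γ₁.weight v)
    (hw₂ : ∀ v, Γ.weight (i₂ v) = Γ₂.weight v) : Iso (glue h.matching) Γ where
  onV := Equiv.ofBijective _ h.vertex_bijective
  onE := Equiv.ofBijective _ h.edge_bijective
  tail_comp e := by
    rcases e with a | b
    · exact (h.tail₁ a).trans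
        (Option.map_map (Sum.elim i₁ i₂) Sum.inl (Γ₁.tail a)).symm
    · obtain ⟨w, hw⟩ := Option.ne_none_iff_exists'.1 b.2
      refine (h.tail₂ b.1 w hw).trans ?_
      change _ = ((Γ₂.tail b.1).map Sum.inr).map _
      rw [hw]
      rfl
  head_comp e := by
    rcases e with a | b
    · change Γ.head (j₁ a) = (glueHead h.matching (Sum.inl a)).map (Sum.elim i₁ i₂)
      by_cases ha : Γ₁.head a = none
      · rw [← h.j₂_matching ⟨a, ha⟩, h.head₂]
        simp only [glueHead, Sum.elim_inl, dif_pos ha, Option.map_map]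
        rfl
      · obtain ⟨v, hv⟩ := Option.ne_none_iff_exists'.1 ha
        rw [h.head₁ a v hv]
        simp [glueHead, hv]
    · exact (h.head₂ b.1).trans
        (Option.map_map (Sum.elim i₁ i₂) Sum.inr (Γ₂.head b.1)).symm
  weight_comp v := by
    rcases v with v | v
    · exact hw₁ v
    · exact hw₂ v

end IsGluing

theorem gluingOfCut_surjective :
    Function.Surjective (gluingOfCut (Γ₁ := Γ₁) (Γ₂ := Γ₂) (Γ := Γ)) := fun t =>
  ⟨⟨t.2.1.cut, t.2.1.isoLower t.2.2.1, t.2.1.isoUpper t.2.2.2⟩, rfl⟩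

def gluingOfGlue (y : Σ σ : Γ₁.SinkEdge ≃ Γ₂.SourceEdge, Iso (glue σ) Γ) : Gluing Γ₁ Γ₂ Γ :=
  ⟨((y.2.onV ∘ Sum.inl, y.2.onV ∘ Sum.inr), (y.2.onE ∘ Sum.inl, y.2.onE ∘ glueInr y.1)),
    (isGluing_glue' y.1).postcomp y.2, fun v => y.2.weight_comp (Sum.inl v),
      fun v => y.2.weight_comp (Sum.inr v)⟩

/-- The matching is determined by the edge maps: `σ a` is the only edge of `Γ₂` with the same image
in `Γ` as `a`. -/
theorem gluingOfGlue_injective :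
    Function.Injective (gluingOfGlue (Γ₁ := Γ₁) (Γ₂ := Γ₂) (Γ := Γ)) := by
  rintro ⟨σ, f⟩ ⟨τ, g⟩ h
  have h1 := congrArg Subtype.val h
  have hV₁ : ∀ v, f.onV (Sum.inl v) = g.onV (Sum.inl v) :=
    congrFun (congrArg (fun t => t.1.1) h1)
  have hV₂ : ∀ v, f.onV (Sum.inr v) = g.onV (Sum.inr v) :=
    congrFun (congrArg (fun t => t.1.2) h1)
  have hE₁ : ∀ v, f.onE (Sum.inl v) = g.onE (Sum.inl v) :=
    congrFun (congrArg (fun t => t.2.1) h1)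
  have hE₂ : ∀ v, f.onE (glueInr σ v) = g.onE (glueInr τ v) :=
    congrFun (congrArg (fun t => t.2.2) h1)
  obtain rfl : σ = τ := by
    refine Equiv.ext fun a => Subtype.ext ?_
    refine ((isGluing_glue' τ).postcomp g).j₂_inj ?_
    change g.onE (glueInr τ _) = g.onE (glueInr τ _)
    rw [← hE₂, glueInr_apply, glueInr_apply]
    exact hE₁ _
  have : f = g := by
    refine Iso.ext_apply ?_ ?_
    · rintro (v | v)
      · exact hV₁ v
      · exact hV₂ v
    · rintro (a | b)
      · exact hE₁ a
      · have := hE₂ b.1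
        rwa [glueInr_of_ne σ b.2] at this
  rw [this]

theorem gluingOfGlue_surjective :
    Function.Surjective (gluingOfGlue (Γ₁ := Γ₁) (Γ₂ := Γ₂) (Γ := Γ)) := by
  intro t
  refine ⟨⟨t.2.1.matching, t.2.1.isoGlue t.2.2.1 t.2.2.2⟩, Subtype.ext (Prod.ext rfl
    (Prod.ext rfl (funext fun b => ?_)))⟩
  have h := t.2.1
  change (Sum.elim t.1.2.1 fun b : {b // Γ₂.tail b ≠ none} => t.1.2.2 b.1) (glueInr h.matching b) = _
  by_cases hb : Γ₂.tail b = none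
  · rw [glueInr_of_none _ hb, Sum.elim_inl, ← h.j₂_matching, Equiv.apply_symm_apply]
  · rw [glueInr_of_ne _ hb, Sum.elim_inr]

open Classical in
/-- Double counting of the ways in which `Γ` is composed of `Γ₁` and `Γ₂`. -/
theorem sum_card_iso_glue (Γ₁ Γ₂ Γ : Graph) :
    ∑ σ : Γ₁.SinkEdge ≃ Γ₂.SourceEdge, Nat.card (Iso (glue σ) Γ) =
      ∑ π : Γ.Cut, Nat.card (Iso Γ₁ (Γ.lowerPiece π)) * Nat.card (Iso Γ₂ (Γ.upperPiece π)) := by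
  -- Both sides become cardinalities of sigma types in bijection with `Gluing Γ₁ Γ₂ Γ`.
  rw [← Nat.card_sigma]
  simp only [← Nat.card_prod]
  rw [← Nat.card_sigma,
    Nat.card_eq_of_bijective _ ⟨gluingOfGlue_injective (Γ₁ := Γ₁) (Γ₂ := Γ₂) (Γ := Γ),
      gluingOfGlue_surjective⟩,
    Nat.card_eq_of_bijective _ ⟨gluingOfCut_injective (Γ₁ := Γ₁) (Γ₂ := Γ₂) (Γ := Γ),
      gluingOfCut_surjective⟩]

end Graph

end PartitionOperators

end

noncomputable section

/-! ### Finiteness of the number of graphs of bounded weight and source degree. -/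

namespace PartitionOperators

namespace Graph

section bounds

variable (Γ : Graph)

theorem card_eq_none_add_sum {V E : Type} [Fintype V] [Fintype E] (f : E → Option V) :
    Nat.card {e // f e = none} + ∑ v, Nat.card {e // f e = some v} = Nat.card E := by
  classical
  rw [← Nat.card_congr (Equiv.sigmaFiberEquiv f), Nat.card_sigma, Fintype.sum_option]

def vertexWeight (v : Γ.V) : ℕ := ((Γ.outDegree v : ℤ) + Γ.weight v).toNat

theorem vertexWeight_cast (v : Γ.V) : (Γ.vertexWeight v : ℤ) = Γ.outDegree v + Γ.weight v := by
  have h1 := Γ.neg_one_le_weight v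
  have h2 : 1 ≤ Γ.outDegree v := Γ.one_le_out v
  unfold vertexWeight
  omega

theorem outDegree_le (v : Γ.V) : Γ.outDegree v ≤ Γ.vertexWeight v + 1 := by
  have h1 := Γ.neg_one_le_weight v
  have h2 := Γ.vertexWeight_cast v
  omega

theorem two_le_inDegree_add (v : Γ.V) : 2 ≤ Γ.inDegree v + Γ.vertexWeight v := by
  have h1 : 2 ≤ (Γ.inDegree v : ℤ) + Γ.outDegree v + Γ.weight v := Γ.two_le v
  have h2 := Γ.vertexWeight_cast v
  omega

theorem card_edges_out : Γ.sourceDegree + ∑ v, Γ.outDegree v = Nat.card Γ.E :=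
  card_eq_none_add_sum Γ.tail

theorem card_edges_in : Γ.sinkDegree + ∑ v, Γ.inDegree v = Nat.card Γ.E :=
  card_eq_none_add_sum Γ.head

theorem sum_outDegree_le : ∑ v, Γ.outDegree v ≤ Γ.opWeight + Nat.card Γ.V := by
  have h := Finset.sum_le_sum fun v (_ : v ∈ Finset.univ) => Γ.outDegree_le v
  rw [Finset.sum_add_distrib, Finset.sum_const, Finset.card_univ, smul_eq_mul, mul_one,
    ← Nat.card_eq_fintype_card] at h
  exact h

/-- With `w = q + r`, each vertex has `p ≥ 2 - w` and `q ≤ w + 1`. Counting the edges by heads and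
by tails gives `2|V| - Ŵ + sink ≤ source + Ŵ + |V|`. -/
theorem card_vertices_add_sinkDegree_le :
    Nat.card Γ.V + Γ.sinkDegree ≤ Γ.sourceDegree + 2 * Γ.opWeight := by
  have h1 := Finset.sum_le_sum fun v (_ : v ∈ Finset.univ) => Γ.two_le_inDegree_add v
  rw [Finset.sum_add_distrib, Finset.sum_const, Finset.card_univ, smul_eq_mul,
    ← Nat.card_eq_fintype_card] at h1
  have h2 : ∑ v, Γ.vertexWeight v = Γ.opWeight := rfl
  have h3 := Γ.sum_outDegree_le
  have h4 := Γ.card_edges_in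
  have h5 := Γ.card_edges_out
  omega

theorem weight_le (v : Γ.V) : Γ.weight v ≤ Γ.opWeight := by
  have h1 : Γ.vertexWeight v ≤ Γ.opWeight :=
    Finset.single_le_sum (f := Γ.vertexWeight) (fun _ _ => Nat.zero_le _) (Finset.mem_univ v)
  have h2 := Γ.vertexWeight_cast v
  omega

end bounds

theorem iso_of_code {n k : ℕ} {Γ Δ : Graph} (eV : Γ.V ≃ Fin n) (eE : Γ.E ≃ Fin k)
    (dV : Δ.V ≃ Fin n) (dE : Δ.E ≃ Fin k)
    (ht : ∀ i, (Γ.tail (eE.symm i)).map eV = (Δ.tail (dE.symm i)).map dV)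
    (hh : ∀ i, (Γ.head (eE.symm i)).map eV = (Δ.head (dE.symm i)).map dV)
    (hw : ∀ i, Γ.weight (eV.symm i) = Δ.weight (dV.symm i)) : Nonempty (Iso Γ Δ) := by
  have key : ∀ (a : Option Γ.V) (b : Option Δ.V), a.map eV = b.map dV →
      b = a.map (eV.trans dV.symm) := by
    intro a b hab
    have := congrArg (Option.map dV.symm) hab
    rw [Option.map_map, Option.map_map] at this
    simpa using this.symm
  refine ⟨⟨eV.trans dV.symm, eE.trans dE.symm, fun e => key _ _ ?_, fun e => key _ _ ?_,
    fun v => ?_⟩⟩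
  · simpa using ht (eE e)
  · simpa using hh (eE e)
  · simpa using (hw (eV v)).symm

end Graph

open PartitionOperators.Graph

theorem IsoClass.mk_rep (γ : IsoClass) : (Quotient.mk _ γ.rep : IsoClass) = γ := Quotient.out_eq γ

theorem IsoClass.mk_eq_iff {Γ Δ : Graph} :
    (Quotient.mk _ Γ : IsoClass) = Quotient.mk _ Δ ↔ Nonempty (Iso Γ Δ) := Quotient.eq

theorem IsoClass.mk_eq_iff_rep {Γ : Graph} {γ : IsoClass} :
    Quotient.mk _ Γ = γ ↔ Nonempty (Iso Γ γ.rep) := by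
  rw [← IsoClass.mk_eq_iff, IsoClass.mk_rep]

/-- After numbering vertices and edges, a class is encoded by its tails, heads and weights. The
weights lie in `[-1, N]`, so there are finitely many codes. -/
theorem finite_isoClass_of_card (n k N : ℕ) :
    {γ : IsoClass | Nat.card γ.rep.V = n ∧ Nat.card γ.rep.E = k ∧
      γ.rep.opWeight ≤ N}.Finite := by
  let S := {γ : IsoClass // Nat.card γ.rep.V = n ∧ Nat.card γ.rep.E = k ∧ γ.rep.opWeight ≤ N}
  have eV : ∀ γ : S, γ.1.rep.V ≃ Fin n := fun γ =>
    Fintype.equivFinOfCardEq (by rw [← Nat.card_eq_fintype_card]; exact γ.2.1)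
  have eE : ∀ γ : S, γ.1.rep.E ≃ Fin k := fun γ =>
    Fintype.equivFinOfCardEq (by rw [← Nat.card_eq_fintype_card]; exact γ.2.2.1)
  let code : S → (Fin k → Option (Fin n)) × (Fin k → Option (Fin n)) ×
      (Fin n → Set.Icc (-1 : ℤ) N) := fun γ =>
    (fun i => (γ.1.rep.tail ((eE γ).symm i)).map (eV γ),
     fun i => (γ.1.rep.head ((eE γ).symm i)).map (eV γ),
     fun i => ⟨γ.1.rep.weight ((eV γ).symm i), γ.1.rep.neg_one_le_weight _,
      (γ.1.rep.weight_le _).trans (by exact_mod_cast γ.2.2.2)⟩)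
  have hcode : Function.Injective code := by
    intro γ δ h
    refine Subtype.ext ?_
    rw [← IsoClass.mk_rep γ.1, ← IsoClass.mk_rep δ.1, IsoClass.mk_eq_iff]
    exact iso_of_code (eV γ) (eE γ) (eV δ) (eE δ) (congrFun (congrArg Prod.fst h))
      (congrFun (congrArg (fun c => c.2.1) h))
      fun i => congrArg Subtype.val (congrFun (congrArg (fun c => c.2.2) h) i)
  exact Set.finite_coe_iff.1 (Finite.of_injective code hcode)

theorem finite_isoClass (N : ℕ) :
    {γ : IsoClass | γ.rep.opWeight + γ.rep.sourceDegree < N}.Finite := by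
  -- There are at most `source + 2Ŵ ≤ 2N` vertices, and the edges, counted by tails, number at most
  -- `source + Ŵ + |V| ≤ 3N`.
  refine Set.Finite.subset (Set.Finite.biUnion (Set.finite_Iic (2 * N)) fun n _ =>
    Set.Finite.biUnion (Set.finite_Iic (3 * N)) fun k _ => finite_isoClass_of_card n k N) ?_
  intro γ hγ
  have h0 : γ.rep.opWeight + γ.rep.sourceDegree < N := hγ
  have h1 := γ.rep.card_vertices_add_sinkDegree_le
  have h2 := γ.rep.sum_outDegree_le
  have h3 := γ.rep.card_edges_out
  simp only [Set.mem_iUnion, Set.mem_Iic, exists_prop]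
  exact ⟨_, by omega, _, by omega, rfl, rfl, by omega⟩

end PartitionOperators

end

noncomputable section

/-! ### Convergence of the series and the composition formula. -/

namespace PartitionOperators

open MvPowerSeries FockSpace PartitionOperators.Graph

namespace FockSpace

variable {m : ℕ}

theorem nu_pow_mem (w : ℕ) : (nu ^ w : FockSpace m) ∈ maxIdeal m ^ w :=
  Ideal.pow_mem_pow (Ideal.subset_span (Set.mem_range_self none)) w

theorem prod_eta_mem {S : Type*} [Fintype S] (I : S → Fin m) :
    ∏ s, (eta (I s) : FockSpace m) ∈ maxIdeal m ^ Fintype.card S := by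
  classical
  rw [prod_eta]
  refine mem_maxIdeal_pow.2 fun n hn => coeff_monomial_ne ?_ _
  rintro rfl
  rw [degree_exponent] at hn
  exact lt_irrefl _ hn

theorem taylorCoeff_mem {S : Type*} [Fintype S] (I : S → Fin m) {N : ℕ} {f : FockSpace m}
    (hf : f ∈ maxIdeal m ^ (N + Fintype.card S)) : taylorCoeff I f ∈ maxIdeal m ^ N := by
  refine mem_maxIdeal_pow.2 fun n hn => ?_
  rw [coeff_taylorCoeff, mem_maxIdeal_pow.1 hf _ (by rw [map_add, degree_exponent]; omega),
    mul_zero, ite_self]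

theorem smul_mem_maxIdeal_pow {N : ℕ} (a : ℂ) {f : FockSpace m} (hf : f ∈ maxIdeal m ^ N) :
    a • f ∈ maxIdeal m ^ N := by
  rw [smul_eq_C_mul]
  exact Ideal.mul_mem_left _ _ hf

end FockSpace

namespace FormalPotential

variable {m : ℕ} (P : FormalPotential m) (x : Fin m → ℂ)

theorem partitionOperator_mem (Γ : Graph) (f : FockSpace m) :
    P.partitionOperator x Γ f ∈ maxIdeal m ^ Γ.sourceDegree := by
  classical
  rw [partitionOperator_apply]
  refine smul_mem_maxIdeal_pow _ (sum_mem fun c _ => smul_mem_maxIdeal_pow _ ?_)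
  refine Ideal.mul_mem_right _ _ ?_
  rw [sourceDegree, Nat.card_eq_fintype_card]
  exact prod_eta_mem _

theorem partitionOperator_mem_of_mem (Γ : Graph) {N : ℕ} {f : FockSpace m}
    (hf : f ∈ maxIdeal m ^ (N + Γ.sinkDegree)) :
    P.partitionOperator x Γ f ∈ maxIdeal m ^ N := by
  classical
  rw [partitionOperator_apply]
  refine smul_mem_maxIdeal_pow _ (sum_mem fun c _ => smul_mem_maxIdeal_pow _ ?_)
  refine Ideal.mul_mem_left _ _ (taylorCoeff_mem _ ?_)
  rwa [sinkDegree, Nat.card_eq_fintype_card] at hf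

theorem partitionOperator_nu_pow_mul (Γ : Graph) (w : ℕ) (f : FockSpace m) :
    P.partitionOperator x Γ (nu ^ w * f) = nu ^ w * P.partitionOperator x Γ f := by
  classical
  rw [partitionOperator_apply, partitionOperator_apply, mul_smul_comm, Finset.mul_sum]
  congr 1
  refine Finset.sum_congr rfl fun c _ => ?_
  rw [mul_smul_comm, colorTerm, colorTerm, taylorCoeff_nu_pow_mul, mul_left_comm]

/-- The term of the series `∑ ν^{Ŵ(Γ)} c_Γ Γ̂`. -/
def seriesTerm (c : IsoClass → ℂ) (γ : IsoClass) : FockSpace m →ₗ[ℂ] FockSpace m :=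
  LinearMap.mulLeft ℂ (nu ^ γ.rep.opWeight) ∘ₗ (c γ • P.partitionOperator x γ.rep)

theorem seriesTerm_apply (c : IsoClass → ℂ) (γ : IsoClass) (f : FockSpace m) :
    P.seriesTerm x c γ f = nu ^ γ.rep.opWeight * (c γ • P.partitionOperator x γ.rep f) := rfl

theorem represents_iff {c : IsoClass → ℂ} {A : FockSpace m →L[ℂ] FockSpace m} :
    P.Represents x c A ↔ ∀ f, HasSum (fun γ => P.seriesTerm x c γ f) (A f) := Iff.rfl

theorem weighted_mem {N : ℕ} (a : ℂ) {γ : IsoClass} (f : FockSpace m)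
    (h : N ≤ γ.rep.opWeight + γ.rep.sourceDegree) :
    nu ^ γ.rep.opWeight * (a • P.partitionOperator x γ.rep f) ∈ maxIdeal m ^ N := by
  refine Ideal.pow_le_pow_right h ?_
  rw [pow_add]
  exact Ideal.mul_mem_mul (nu_pow_mem _) (smul_mem_maxIdeal_pow _ (P.partitionOperator_mem x _ _))

theorem seriesTerm_finite (c : IsoClass → ℂ) (f : FockSpace m) (N : ℕ) :
    {γ | P.seriesTerm x c γ f ∉ maxIdeal m ^ N}.Finite :=
  (finite_isoClass N).subset fun _ hγ => not_le.1 fun h => hγ (P.weighted_mem x _ f h)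

/-- If `Ŵ + source < N`, the sink degree is at most `2N`, so the derivatives still leave the
exponent `3N - 2N = N`; otherwise the term lies in the `N`-th power for every `f`. The bound is
uniform in `γ`, which yields continuity of the whole sum. -/
theorem seriesTerm_mem (c : IsoClass → ℂ) (γ : IsoClass) {N : ℕ} {f : FockSpace m}
    (hf : f ∈ maxIdeal m ^ (3 * N)) : P.seriesTerm x c γ f ∈ maxIdeal m ^ N := by
  by_cases h : N ≤ γ.rep.opWeight + γ.rep.sourceDegree
  · exact P.weighted_mem x _ f h
  · refine Ideal.mul_mem_left _ _ (smul_mem_maxIdeal_pow _ (P.partitionOperator_mem_of_mem x _ ?_))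
    have := γ.rep.card_vertices_add_sinkDegree_le
    exact Ideal.pow_le_pow_right (by omega) hf

theorem summable_seriesTerm (c : IsoClass → ℂ) (f : FockSpace m) :
    Summable fun γ => P.seriesTerm x c γ f :=
  summable_of_finite (P.seriesTerm_finite x c f)

theorem continuous_seriesTerm (c : IsoClass → ℂ) (γ : IsoClass) :
    Continuous (P.seriesTerm x c γ) :=
  continuous_of_pow _ fun N => ⟨3 * N, fun _ => P.seriesTerm_mem x c γ⟩

/-- The operator `∑ ν^{Ŵ(Γ)} c_Γ Γ̂`. -/
def seriesLinear (c : IsoClass → ℂ) : FockSpace m →ₗ[ℂ] FockSpace m where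
  toFun f := ∑' γ, P.seriesTerm x c γ f
  map_add' f g := by
    simp only [map_add]
    exact (P.summable_seriesTerm x c f).tsum_add (P.summable_seriesTerm x c g)
  map_smul' a f := by
    simp only [map_smul]
    exact (P.summable_seriesTerm x c f).tsum_const_smul a

theorem hasSum_seriesLinear (c : IsoClass → ℂ) (f : FockSpace m) :
    HasSum (fun γ => P.seriesTerm x c γ f) (P.seriesLinear x c f) :=
  (P.summable_seriesTerm x c f).hasSum

theorem existsUnique_represents (c : IsoClass → ℂ) :
    ∃! A : FockSpace m →L[ℂ] FockSpace m, P.Represents x c A := by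
  refine ⟨⟨P.seriesLinear x c, continuous_of_pow _ fun N => ⟨3 * N, fun f hf => ?_⟩⟩,
    P.hasSum_seriesLinear x c, fun A hA => ?_⟩
  · exact (isClosed_maxIdeal_pow N).mem_of_tendsto (P.hasSum_seriesLinear x c f)
      (Filter.Eventually.of_forall fun s => sum_mem fun γ _ => P.seriesTerm_mem x c γ hf)
  · ext1 f
    exact (hA f).unique (P.hasSum_seriesLinear x c f)

section composition

variable (a b : IsoClass → ℂ) (f : FockSpace m)

/-- The contribution to the product of two series of the ways in which a graph of the class `γ` is
composed of graphs of the classes `γ₁` and `γ₂`. -/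
def gluingTerm (γ₁ γ₂ γ : IsoClass) : FockSpace m :=
  nu ^ γ.rep.opWeight * (((∑ π : γ.rep.Cut, Nat.card (Iso γ₁.rep (γ.rep.lowerPiece π)) *
    Nat.card (Iso γ₂.rep (γ.rep.upperPiece π)) : ℕ) * (a γ₁ * b γ₂ / (γ₁.rep.autCard *
      γ₂.rep.autCard * γ₁.rep.sinkDegree.factorial * γ.rep.autCard)) : ℂ) •
        P.partitionOperator x γ.rep f)

/-- Only finitely many `γ` matter modulo the `N`-th power, and for each of them `γ₁` and `γ₂` must
be the classes of the two pieces of one of its finitely many cuts. The triple family is therefore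
summable in any order. -/
theorem gluingTerm_finite (N : ℕ) :
    {p : (IsoClass × IsoClass) × IsoClass |
      P.gluingTerm x a b f p.1.1 p.1.2 p.2 ∉ maxIdeal m ^ N}.Finite := by
  refine Set.Finite.subset (Set.Finite.biUnion (finite_isoClass N) fun γ _ =>
    Set.finite_range fun π : γ.rep.Cut => (((Quotient.mk _ (γ.rep.lowerPiece π) : IsoClass),
      (Quotient.mk _ (γ.rep.upperPiece π) : IsoClass)), γ)) ?_
  rintro ⟨⟨γ₁, γ₂⟩, γ⟩ h
  simp only [Set.mem_iUnion, Set.mem_range, exists_prop]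
  refine ⟨γ, not_le.1 fun hle => h (P.weighted_mem x _ f hle), ?_⟩
  by_contra! hc
  refine h ?_
  have h0 : (∑ π : γ.rep.Cut, Nat.card (Iso (IsoClass.rep γ₁) (γ.rep.lowerPiece π)) *
      Nat.card (Iso (IsoClass.rep γ₂) (γ.rep.upperPiece π))) = 0 := by
    refine Finset.sum_eq_zero fun π _ => ?_
    by_contra hne
    obtain ⟨h1, h2⟩ := mul_ne_zero_iff.1 hne
    obtain ⟨⟨e₁⟩, -⟩ := Nat.card_ne_zero.1 h1
    obtain ⟨⟨e₂⟩, -⟩ := Nat.card_ne_zero.1 h2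
    refine hc π ?_
    rw [IsoClass.mk_eq_iff_rep.2 ⟨e₁.symm⟩, IsoClass.mk_eq_iff_rep.2 ⟨e₂.symm⟩]
  simp only [gluingTerm, h0, Nat.cast_zero, zero_mul, zero_smul, mul_zero]
  exact zero_mem _

/-- Summation over the pieces. -/
theorem hasSum_gluingTerm_pieces (γ : IsoClass) :
    HasSum (fun q : IsoClass × IsoClass => P.gluingTerm x a b f q.1 q.2 γ)
      (P.seriesTerm x (fun γ => cutSum a b γ.rep / (γ.rep.autCard : ℂ)) γ f) := by
  have h1 : ∀ q : IsoClass × IsoClass, P.gluingTerm x a b f q.1 q.2 γ =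
      ∑ π : γ.rep.Cut, nu ^ γ.rep.opWeight *
        (((Nat.card (Iso q.1.rep (γ.rep.lowerPiece π)) *
          Nat.card (Iso q.2.rep (γ.rep.upperPiece π)) : ℕ) * (a q.1 * b q.2 / (q.1.rep.autCard *
          q.2.rep.autCard * q.1.rep.sinkDegree.factorial * γ.rep.autCard)) : ℂ) •
            P.partitionOperator x γ.rep f) := by
    intro q
    rw [gluingTerm, Nat.cast_sum, Finset.sum_mul, Finset.sum_smul, Finset.mul_sum]
  have h2 : P.seriesTerm x (fun γ => cutSum a b γ.rep / (γ.rep.autCard : ℂ)) γ f =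
      ∑ π : γ.rep.Cut, nu ^ γ.rep.opWeight *
        ((a (Quotient.mk _ (γ.rep.lowerPiece π)) * b (Quotient.mk _ (γ.rep.upperPiece π)) /
          ((γ.rep.cutCard π).factorial : ℂ) / (γ.rep.autCard : ℂ)) •
            P.partitionOperator x γ.rep f) := by
    rw [seriesTerm_apply, cutSum, Finset.sum_div, Finset.sum_smul, Finset.mul_sum]
  rw [h2]
  simp only [h1]
  refine hasSum_sum fun π _ => ?_
  let q₀ : IsoClass × IsoClass :=
    (Quotient.mk _ (γ.rep.lowerPiece π), Quotient.mk _ (γ.rep.upperPiece π))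
  obtain ⟨e₁⟩ : Nonempty (Iso (γ.rep.lowerPiece π) q₀.1.rep) := IsoClass.mk_eq_iff_rep.1 rfl
  obtain ⟨e₂⟩ : Nonempty (Iso (γ.rep.upperPiece π) q₀.2.rep) := IsoClass.mk_eq_iff_rep.1 rfl
  convert hasSum_single q₀ ?_ using 1
  · have hd : q₀.1.rep.sinkDegree = γ.rep.cutCard π := by
      rw [← sinkDegree_congr e₁, sinkDegree_lowerPiece]
    rw [card_iso_left e₁.symm, card_iso_left e₂.symm, hd]
    have n1 : (q₀.1.rep.autCard : ℂ) ≠ 0 := Nat.cast_ne_zero.2 (autCard_ne_zero _)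
    have n2 : (q₀.2.rep.autCard : ℂ) ≠ 0 := Nat.cast_ne_zero.2 (autCard_ne_zero _)
    have n3 : (γ.rep.autCard : ℂ) ≠ 0 := Nat.cast_ne_zero.2 (autCard_ne_zero _)
    have n4 : ((γ.rep.cutCard π).factorial : ℂ) ≠ 0 := Nat.cast_ne_zero.2 (Nat.factorial_ne_zero _)
    congr 2
    change a q₀.1 * b q₀.2 / _ / _ = _
    push_cast
    field_simp
  · intro q hq
    have : Nat.card (Iso q.1.rep (γ.rep.lowerPiece π)) *
        Nat.card (Iso q.2.rep (γ.rep.upperPiece π)) = 0 := by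
      by_contra hne
      obtain ⟨h1, h2⟩ := mul_ne_zero_iff.1 hne
      obtain ⟨⟨e₁⟩, -⟩ := Nat.card_ne_zero.1 h1
      obtain ⟨⟨e₂⟩, -⟩ := Nat.card_ne_zero.1 h2
      exact hq (Prod.ext (IsoClass.mk_eq_iff_rep.2 ⟨e₁.symm⟩).symm
        (IsoClass.mk_eq_iff_rep.2 ⟨e₂.symm⟩).symm)
    rw [this, Nat.cast_zero, zero_mul, zero_smul, mul_zero]

open Classical in
/-- Summation over the composed graphs. -/
theorem hasSum_gluingTerm_glue (γ₁ γ₂ : IsoClass) :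
    HasSum (fun γ => P.gluingTerm x a b f γ₁ γ₂ γ)
      (P.seriesTerm x (fun γ => a γ / (γ.rep.autCard : ℂ)) γ₁
        (P.seriesTerm x (fun γ => b γ / (γ.rep.autCard : ℂ)) γ₂ f)) := by
  have h1 : ∀ γ, P.gluingTerm x a b f γ₁ γ₂ γ =
      ∑ σ : γ₁.rep.SinkEdge ≃ γ₂.rep.SourceEdge, nu ^ γ.rep.opWeight *
        ((Nat.card (Iso (glue σ) γ.rep) * (a γ₁ * b γ₂ / (γ₁.rep.autCard *
          γ₂.rep.autCard * γ₁.rep.sinkDegree.factorial * γ.rep.autCard)) : ℂ) •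
            P.partitionOperator x γ.rep f) := by
    intro γ
    rw [gluingTerm, ← sum_card_iso_glue, Nat.cast_sum, Finset.sum_mul, Finset.sum_smul,
      Finset.mul_sum]
  have h2 : P.seriesTerm x (fun γ => a γ / (γ.rep.autCard : ℂ)) γ₁
        (P.seriesTerm x (fun γ => b γ / (γ.rep.autCard : ℂ)) γ₂ f) =
      ∑ σ : γ₁.rep.SinkEdge ≃ γ₂.rep.SourceEdge, nu ^ (γ₁.rep.opWeight + γ₂.rep.opWeight) *
        ((a γ₁ * b γ₂ / (γ₁.rep.autCard * γ₂.rep.autCard * γ₁.rep.sinkDegree.factorial) : ℂ) •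
          P.partitionOperator x (glue σ) f) := by
    rw [seriesTerm_apply, seriesTerm_apply, partitionOperator_nu_pow_mul, map_smul,
      partitionOperator_comp, ← Finset.mul_sum, ← Finset.smul_sum, pow_add, mul_assoc]
    simp only [mul_smul_comm, smul_smul]
    congr 1
    field_simp
  rw [h2]
  simp only [h1]
  refine hasSum_sum fun σ _ => ?_
  let γ₀ : IsoClass := Quotient.mk _ (glue σ)
  obtain ⟨e⟩ : Nonempty (Iso (glue σ) γ₀.rep) := IsoClass.mk_eq_iff_rep.1 rfl
  -- Only the class of the glued graph contributes, and its number of isomorphisms cancels `|Aut|`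
  -- of that class.
  convert hasSum_single γ₀ ?_ using 1
  · rw [card_iso_right e, ← opWeight_congr e, opWeight_glue, ← P.partitionOperator_congr x e]
    have n3 : (γ₀.rep.autCard : ℂ) ≠ 0 := Nat.cast_ne_zero.2 (autCard_ne_zero _)
    congr 2
    field_simp
  · intro γ hγ
    have : Nat.card (Iso (glue σ) γ.rep) = 0 := by
      by_contra hne
      obtain ⟨⟨e⟩, -⟩ := Nat.card_ne_zero.1 hne
      exact hγ (IsoClass.mk_eq_iff_rep.2 ⟨e⟩).symm
    rw [this, Nat.cast_zero, zero_mul, zero_smul, mul_zero]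

end composition

/-- The summable family `gluingTerm` is added up in two orders: over `γ` first it gives the product
of the series, over `(γ₁, γ₂)` first the series with coefficients `cutSum`. -/
theorem represents_mul (a b : IsoClass → ℂ) (A B : FockSpace m →L[ℂ] FockSpace m)
    (hA : P.Represents x (fun γ => a γ / (γ.rep.autCard : ℂ)) A)
    (hB : P.Represents x (fun γ => b γ / (γ.rep.autCard : ℂ)) B) :
    P.Represents x (fun γ => cutSum a b γ.rep / (γ.rep.autCard : ℂ)) (A * B) := by
  rw [represents_iff] at *
  intro f
  obtain ⟨s, hs⟩ := summable_of_finite (P.gluingTerm_finite x a b f)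
  have hL := hs.prod_fiberwise fun q => P.hasSum_gluingTerm_glue x a b f q.1 q.2
  have hR := ((Equiv.prodComm _ _).hasSum_iff.2 hs).prod_fiberwise
    fun γ => P.hasSum_gluingTerm_pieces x a b f γ
  -- Each term of `A` is continuous, so it may be applied to the series for `B f` term by term.
  have h1 := hL.prod_fiberwise fun γ₁ =>
    (hB f).map (P.seriesTerm x (fun γ => a γ / (γ.rep.autCard : ℂ)) γ₁)
      (P.continuous_seriesTerm x _ γ₁)
  rw [h1.unique (hA (B f))] at hR
  exact hR

end FormalPotential

end PartitionOperators

end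

noncomputable section

/-! ### The unit and the subalgebra. -/

namespace PartitionOperators

open MvPowerSeries FockSpace PartitionOperators.Graph

/-- The multinomial count of the words with a given exponent. -/
theorem sum_etaFactorial {m : ℕ} {E : Type*} [Fintype E] [DecidableEq E] (c₀ : E → Fin m) :
    ∑ c : E → Fin m, (if exponent c = exponent c₀ then etaFactorial (exponent c) else 0) =
      (Fintype.card E).factorial := by
  classical
  simp only [← card_matchings]
  rw [← Nat.card_sigma, ← Fintype.card_perm, ← Nat.card_eq_fintype_card]
  refine Nat.card_congr
    { toFun := fun y => y.2.1
      invFun := fun σ => ⟨c₀ ∘ σ, σ, fun _ => rfl⟩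
      left_inv := ?_
      right_inv := fun _ => rfl }
  rintro ⟨c, σ, h⟩
  obtain rfl : c₀ ∘ σ = c := funext h
  rfl

theorem exists_exponent_eq {m : ℕ} {E : Type} [Fintype E] (β : Option (Fin m) →₀ ℕ)
    (hβ : β none = 0) (hcard : Fintype.card E = ∑ k, β (some k)) :
    ∃ c : E → Fin m, exponent c = β := by
  have hc : Fintype.card (Σ k : Fin m, Fin (β (some k))) = Fintype.card E := by
    simp [hcard]
  obtain ⟨e⟩ := Fintype.card_eq.1 hc
  refine ⟨fun a => (e.symm a).1, Finsupp.ext fun i => ?_⟩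
  cases i with
  | none => rw [exponent_none, hβ]
  | some k =>
    rw [exponent_some, Nat.card_congr (e.symm.subtypeEquiv (q := fun s => s.1 = k) fun a => Iff.rfl),
      Nat.card_congr (Equiv.sigmaSubtype k), Nat.card_fin]

namespace FormalPotential

variable {m : ℕ} (P : FormalPotential m) (x : Fin m → ℂ)

open Classical in
/-- The partition operator of a graph with `k` edges and without internal vertices maps a formal
series to its homogeneous component of degree `k` in the `η`'s. -/
theorem coeff_partitionOperator_of_isEmpty (Γ : Graph) [IsEmpty Γ.V] (f : FockSpace m)
    (n : Option (Fin m) →₀ ℕ) : coeff n (P.partitionOperator x Γ f) =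
      if Fintype.card Γ.E = ∑ k, n (some k) then coeff n f else 0 := by
  have hnone : ∀ a : Option Γ.V, a = none := fun a => by
    cases a with
    | none => rfl
    | some v => exact isEmptyElim v
  let es : Γ.SourceEdge ≃ Γ.E := Equiv.subtypeUnivEquiv fun e => hnone _
  let et : Γ.SinkEdge ≃ Γ.E := Equiv.subtypeUnivEquiv fun e => hnone _
  have hdeg : Γ.sinkDegree = Fintype.card Γ.E :=
    (Nat.card_congr et).trans Nat.card_eq_fintype_card
  let β : Option (Fin m) →₀ ℕ := n.erase none
  have hβn : β none = 0 := Finsupp.erase_same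
  have hβs : ∀ k, β (some k) = n (some k) := fun k => Finsupp.erase_ne (by simp)
  have hcolor : ∀ c : Γ.E → Fin m, coeff n (colorTerm Γ c f) =
      if exponent c = β then etaFactorial (exponent c) * coeff n f else 0 := by
    intro c
    have hs : exponent (fun e : Γ.SourceEdge => c e.1) = exponent c := exponent_comp c es
    have ht : exponent (fun e : Γ.SinkEdge => c e.1) = exponent c := exponent_comp c et
    rw [colorTerm, prod_eta, coeff_monomial_mul, one_mul, hs]
    by_cases h : exponent c = β
    · have hle : exponent c ≤ n := fun i => by
        cases i with
        | none => rw [exponent_none]; exact Nat.zero_le _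
        | some k => rw [h, hβs]
      rw [if_pos hle, if_pos h, coeff_taylorCoeff, ht, if_pos, tsub_add_cancel_of_le hle]
      intro k
      rw [Finsupp.tsub_apply, h, hβs, tsub_self]
    · rw [if_neg h]
      split_ifs with hle
      · rw [coeff_taylorCoeff, if_neg]
        intro h0
        refine h (Finsupp.ext fun i => ?_)
        cases i with
        | none => rw [exponent_none, hβn]
        | some k =>
          have h1 := hle (some k)
          have h2 := h0 k
          rw [Finsupp.tsub_apply] at h2
          rw [hβs]
          omega
      · rfl
  rw [partitionOperator_apply, coeff_smul, map_sum]
  simp only [Finset.univ_eq_empty, Finset.prod_empty, one_smul, hcolor]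
  split_ifs with hcard
  -- Some colouring realizes the η-exponent of `n`, so the multinomial count gives `k!`, which
  -- cancels the prefactor `1/p!` because `p = k`.
  · obtain ⟨c₀, hc₀⟩ := exists_exponent_eq (E := Γ.E) β hβn (by simp only [hcard, hβs])
    have h := sum_etaFactorial c₀
    rw [hc₀] at h
    have h' : (∑ c : Γ.E → Fin m,
        if exponent c = β then (etaFactorial (exponent c) : ℂ) * coeff n f else 0) =
        (Γ.sinkDegree.factorial : ℂ) * coeff n f := by
      rw [hdeg, ← h, Nat.cast_sum, Finset.sum_mul]
      refine Finset.sum_congr rfl fun c _ => ?_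
      split_ifs <;> simp
    rw [h', inv_mul_cancel_left₀ (Nat.cast_ne_zero.2 (Nat.factorial_ne_zero _))]
  · rw [Finset.sum_eq_zero, mul_zero]
    intro c _
    rw [if_neg]
    intro hc
    refine hcard ?_
    rw [← degree_exponent c, hc, Finsupp.degree_eq_sum, Fintype.sum_option, hβn, zero_add]
    exact Finset.sum_congr rfl fun k _ => hβs k

/-- The graph with `n` edges and without internal vertices. -/
def _root_.PartitionOperators.Graph.edges (n : ℕ) : Graph where
  V := Empty
  E := Fin n
  tail _ := none
  head _ := none
  weight := Empty.elim
  one_le_in v := v.elim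
  one_le_out v := v.elim
  neg_one_le_weight v := v.elim
  two_le v := v.elim
  acyclic v := v.elim

theorem nonempty_iso_edges {Γ : Graph} (hV : IsEmpty Γ.V) {n : ℕ} (hE : Fintype.card Γ.E = n) :
    Nonempty (Iso Γ (Graph.edges n)) :=
  have : IsEmpty (Graph.edges n).V := inferInstanceAs (IsEmpty Empty)
  have hnone : ∀ a : Option Γ.V, a = none := fun a => by
    cases a with
    | none => rfl
    | some v => exact isEmptyElim v
  ⟨⟨Equiv.equivOfIsEmpty _ _, Fintype.equivFinOfCardEq hE, fun e => by rw [hnone (Γ.tail e)]; rfl,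
    fun e => by rw [hnone (Γ.head e)]; rfl, fun v => isEmptyElim v⟩⟩

-- A graph without internal vertices is determined by its number of edges `k` and acts as the
-- projection to η-degree `k`. A coefficient of `f` is thus reproduced by exactly one class.
open Classical in
theorem represents_one :
    P.Represents x (fun γ => if IsEmpty γ.rep.V then 1 else 0) 1 := by
  rw [represents_iff]
  intro f
  refine hasSum_of_coeff (P.seriesTerm_finite x _ f) fun n => ?_
  let N := ∑ k, n (some k)
  let γ₀ : IsoClass := Quotient.mk _ (Graph.edges N)
  obtain ⟨e⟩ : Nonempty (Iso (Graph.edges N) γ₀.rep) := IsoClass.mk_eq_iff_rep.1 rfl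
  have hterm : ∀ γ : IsoClass, coeff n
      (P.seriesTerm x (fun γ => if IsEmpty γ.rep.V then 1 else 0) γ f) =
      if IsEmpty γ.rep.V ∧ Fintype.card γ.rep.E = N then coeff n f else 0 := by
    intro γ
    rw [seriesTerm_apply]
    by_cases hV : IsEmpty γ.rep.V
    · have hw : γ.rep.opWeight = 0 := Fintype.sum_empty _
      rw [if_pos hV, hw, pow_zero, one_mul, one_smul, coeff_partitionOperator_of_isEmpty]
      simp only [hV, true_and, N]
    · rw [if_neg hV, zero_smul, mul_zero, map_zero, if_neg fun h => hV h.1]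
  simp only [hterm]
  rw [finsum_eq_single _ γ₀]
  · rw [if_pos]
    · rfl
    · exact ⟨Function.isEmpty (β := Empty) e.onV.symm,
        (Fintype.card_congr e.onE.symm).trans (Fintype.card_fin N)⟩
  · intro γ hγ
    refine if_neg fun h => hγ ?_
    obtain ⟨e⟩ := nonempty_iso_edges h.1 h.2
    exact (IsoClass.mk_eq_iff_rep.2 ⟨e.symm⟩).symm

theorem Represents.add {P : FormalPotential m} {x : Fin m → ℂ} {c d : IsoClass → ℂ}
    {A B : FockSpace m →L[ℂ] FockSpace m} (hA : P.Represents x c A) (hB : P.Represents x d B) :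
    P.Represents x (c + d) (A + B) := fun f => by
  convert (hA f).add (hB f) using 1
  · funext γ
    rw [Pi.add_apply, add_smul, mul_add]
  · rfl

theorem Represents.smul {P : FormalPotential m} {x : Fin m → ℂ} {c : IsoClass → ℂ}
    {A : FockSpace m →L[ℂ] FockSpace m} (r : ℂ) (hA : P.Represents x c A) :
    P.Represents x (r • c) (r • A) := fun f => by
  convert (hA f).const_smul r using 1
  · funext γ
    rw [Pi.smul_apply, smul_assoc, mul_smul_comm]
  · rfl

/-- The algebra of the operators `∑ ν^{Ŵ(Γ)} c_Γ Γ̂`. -/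
def graphSubalgebra : Subalgebra ℂ (FockSpace m →L[ℂ] FockSpace m) where
  carrier := P.graphOperators x
  add_mem' := fun ⟨_, hA⟩ ⟨_, hB⟩ => ⟨_, hA.add hB⟩
  algebraMap_mem' r := by
    rw [Algebra.algebraMap_eq_smul_one]
    exact ⟨_, (P.represents_one x).smul r⟩
  mul_mem' := by
    rintro A B ⟨c, hA⟩ ⟨d, hB⟩
    -- Multiplying coefficients by `|Aut|` puts an arbitrary series into the normalization of
    -- `represents_mul`.
    have hc : ∀ c : IsoClass → ℂ,
        (fun γ : IsoClass => c γ * γ.rep.autCard / (γ.rep.autCard : ℂ)) = c :=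
      fun c => funext fun γ => mul_div_cancel_right₀ _ (Nat.cast_ne_zero.2 (autCard_ne_zero _))
    exact ⟨_, P.represents_mul x (fun γ => c γ * γ.rep.autCard) (fun γ => d γ * γ.rep.autCard)
      A B (by rwa [hc]) (by rwa [hc])⟩

end FormalPotential

end PartitionOperators

end

theorem mainTheorem3 (m : ℕ) (P : PartitionOperators.FormalPotential m)
    (x : Fin m → ℂ) (hx : x ∈ P.U) :
    (∀ c : PartitionOperators.IsoClass → ℂ,
      ∃! A : PartitionOperators.FockSpace m →L[ℂ] PartitionOperators.FockSpace m,
        P.Represents x c A) ∧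
    (∃ S : Subalgebra ℂ
        (PartitionOperators.FockSpace m →L[ℂ] PartitionOperators.FockSpace m),
      (S : Set (PartitionOperators.FockSpace m →L[ℂ] PartitionOperators.FockSpace m)) =
        P.graphOperators x) ∧
    (∀ (a b : PartitionOperators.IsoClass → ℂ)
      (A B : PartitionOperators.FockSpace m →L[ℂ] PartitionOperators.FockSpace m),
      P.Represents x (fun γ => a γ / (γ.rep.autCard : ℂ)) A →
      P.Represents x (fun γ => b γ / (γ.rep.autCard : ℂ)) B →
      P.Represents x
        (fun γ => PartitionOperators.cutSum a b γ.rep / (γ.rep.autCard : ℂ)) (A * B)) :=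
  ⟨P.existsUnique_represents x, ⟨P.graphSubalgebra x, rfl⟩, P.represents_mul x⟩
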